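/- Let $0<\lambda<\Lambda$. There is a constant $\kappa>0$, depending only on $\lambda$ and $\Lambda$, with the following property. Let $D\subset\mathbb{R}^2$ be a nonempty bounded open set, let $f:\mathbb{R}^2\to\mathbb{R}$ be continuous with $\lambda<f<\Lambda$, and let $g:\partial D\to(0,\infty)$ be continuous. For $v:\mathbb{R}^2\setminus D\to[0,\infty)$ put $\Omega(v)=\{x\in\mathbb{R}^2\setminus D: v(x)>0\}$, with boundary $\partial\Omega(v)$ taken in $\mathbb{R}^2$. Call $v$ a *subsolution* (of the free boundary problem $\Delta v=0$ in $\Omega(v)\setminus D$, $v=g$ on $\partial D$, $v=0$ and $|\nabla v|^2=f$ on $\partial\Omega(v)$) if $v$ is continuous on $\mathbb{R}^2\setminus D$ and 1. $\Delta v\ge 0$ in $\Omega(v)\setminus\overline D$ in the viscosity sense, i.e. every $C^2$ function touching $v$ from above at a point of this set has nonnegative Laplacian there; 2. $v\le g$ on $\partial D$; 3. whenever $x_0\in\partial\Omega(v)$ and $B_s(y)$, $s>0$, is a ball with $B_s(y)\cap\Omega(v)=\emptyset$ and $|x_0-y|=s$, and $\nu=(x_0-y)/s$, then every $\alpha\in\mathbb{R}$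 with $v(x)\le\alpha\langle x-x_0,\nu\rangle^+ +o(|x-x_0|)$ as $x\to x_0$, $x\in\mathbb{R}^2\setminus D$, satisfies $\alpha\ge\sqrt{f(x_0)}$. Fix $p\in D$, $\rho>0$ with $D\subset B_\rho(p)$, and $m>0$; let $$R_0=\inf\Big\{R>\rho:\ \frac{m^2}{R^2\ln^2(\rho/R)}<\lambda\Big\},\qquad h(x)=\Big(\frac{m}{\ln(\rho/R_0)}\,\ln\frac{|x-p|}{R_0}\Big)^+ ,$$ and let $u$ be the largest subsolution below $h$, that is, for $x\in\mathbb{R}^2\setminus D$, $$u(x)=\sup\{v(x):\ v \text{ is a subsolution and } v\le h \text{ on } \mathbb{R}^2\setminus D\}.$$ Then $u$ is non-degenerate: for every $x_0\in\partial\Omega(u)$ and every $r>0$ with $B_r(x_0)\cap D=\emptyset$, $$\sup_{B_r(x_0)}u\ \ge\ \kappa r .$$ -/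

import Mathlib

open Filter Topology

noncomputable section

namespace OnePhaseFBP

/-- The Euclidean plane. -/
abbrev Plane := EuclideanSpace ℝ (Fin 2)

/-- `Ω(v) = {x | v x > 0}` for a function `v` on `ℝ² ∖ D`. Functions on `ℝ² ∖ D` are represented by
functions on the whole plane, whose values on `D` are never used. -/
def posSet (D : Set Plane) (v : Plane → ℝ) : Set Plane :=
  {x | x ∉ D ∧ 0 < v x}

/-- `Δ v ≥ 0` on `U` in the viscosity sense: every `C²` function that touches `v` from above at a
point of `U` has nonnegative Laplacian there. -/
def ViscositySubharmonicOn (v : Plane → ℝ) (U : Set Plane) : Prop :=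
  ∀ x₀ ∈ U, ∀ φ : Plane → ℝ, ContDiffAt ℝ 2 φ x₀ →
    IsLocalMax (fun x => v x - φ x) x₀ → 0 ≤ Laplacian.laplacian φ x₀

/-- The ball `B_s(y)` is tangent from outside to `W` at `x₀`. -/
def IsExteriorTangentBall (W : Set Plane) (x₀ y : Plane) (s : ℝ) : Prop :=
  0 < s ∧ Disjoint (Metric.ball y s) W ∧ dist x₀ y = s

/-- `v(x) ≤ α ⟨x - x₀, ν⟩⁺ + o(|x - x₀|)` as `x → x₀` within `ℝ² ∖ D`. -/
def BelowPlaneAt (D : Set Plane) (v : Plane → ℝ) (x₀ ν : Plane) (α : ℝ) : Prop :=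
  ∀ ε > 0, ∀ᶠ x in 𝓝[Dᶜ] x₀, v x ≤ α * max (inner ℝ (x - x₀) ν) 0 + ε * ‖x - x₀‖

/-- Nonnegative continuous viscosity subsolutions on `ℝ² ∖ D` of
`Δ v = 0` in `Ω(v) ∖ D`, `v = g` on `∂D`, `v = 0` and `|∇ v|² = f` on `∂Ω(v)`.
In `fbc`, the unit vector `(x₀ - y) / s` is the normal at `x₀` pointing away from the exterior
tangent ball `B_s(y)`, that is, into `Ω(v)`. The condition is void at the points of `∂Ω(v)`
where `v > 0` (these lie on `∂D`), since `BelowPlaneAt` forces `v x₀ ≤ 0`. -/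
structure IsSubsolution (D : Set Plane) (f g : Plane → ℝ) (v : Plane → ℝ) : Prop where
  continuousOn : ContinuousOn v Dᶜ
  nonneg : ∀ x ∉ D, 0 ≤ v x
  subharmonic : ViscositySubharmonicOn v (posSet D v \ closure D)
  le_boundary : ∀ x ∈ frontier D, v x ≤ g x
  fbc : ∀ x₀ ∈ frontier (posSet D v), ∀ (y : Plane) (s : ℝ),
    IsExteriorTangentBall (posSet D v) x₀ y s →
      ∀ α : ℝ, BelowPlaneAt D v x₀ (s⁻¹ • (x₀ - y)) α → √(f x₀) ≤ α

/-- `R₀ = inf {R > ρ | m² / (R² ln²(ρ/R)) < lam}`. -/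
def barrierRadius (lam ρ m : ℝ) : ℝ :=
  sInf {R : ℝ | ρ < R ∧ m ^ 2 / (R ^ 2 * Real.log (ρ / R) ^ 2) < lam}

/-- `h(x) = (m / ln(ρ/R₀) · ln(|x - p|/R₀))⁺`: it equals `m` on `∂B_ρ(p)`, vanishes outside
`B_{R₀}(p)`, is harmonic in `B_{R₀}(p) ∖ {p}` and satisfies `|∇ h|² = lam` on `∂B_{R₀}(p)`. -/
def barrier (lam : ℝ) (p : Plane) (ρ m : ℝ) (x : Plane) : ℝ :=
  max (m / Real.log (ρ / barrierRadius lam ρ m) *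
    Real.log (‖x - p‖ / barrierRadius lam ρ m)) 0

/-- The largest subsolution below `h`: the pointwise supremum of all subsolutions `v` with `v ≤ h`
on `ℝ² ∖ D`. -/
def largestSubsolution (D : Set Plane) (f g h : Plane → ℝ) (x : Plane) : ℝ :=
  sSup {t : ℝ | ∃ v : Plane → ℝ, IsSubsolution D f g v ∧ (∀ z ∉ D, v z ≤ h z) ∧ v x = t}

end OnePhaseFBP

end

noncomputable section

namespace OnePhaseFBP

open InnerProductSpace Metric Laplacian

/-! Suppose `u` stays below `κ * r` on `B_r(x₀)`. Points of `Ω(u)` lie arbitrarily close to `x₀`, so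
some subsolution `v ≤ h` is positive at a point of `B_{r/16}(x₀)`, and `v ≤ u` is just as small. The
aim is a subsolution `w ≤ h` that is positive on all of `B_{r/8}(x₀)`: then `u ≥ w` puts `x₀` in the
interior of `Ω(u)`, which is absurd.

The natural `w` replaces `v` by its harmonic extension inside a circle about `x₀`. This may create
free boundary at points of the circle off `closure Ω(v)`, where nothing is known about the slope; if
the whole circle lies in `closure Ω(v)`, every free boundary point of `w` is one of `v` and the
slope condition is inherited (`exists_harmonic_replacement`). So the point is to find such a circle
with radius in `[r/8, r/4]`.

The slope condition and a logarithmic barrier force growth of order `s` next to an exterior tangent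
ball of radius `s` (`exists_lt_of_tangent`). Hence, for small `v`, a zero ball of radius `r/16`
could slide without ever touching `Ω(v)`, even onto the point where `v > 0`; all zero balls are
therefore smaller (`disjoint_ball_of_convex`). If every circle missed `closure Ω(v)` somewhere, each
radius would give an exterior tangent ball of radius `s`. By Harnack, this ball costs `v` a
logarithmic potential of mass comparable to `s` (`exists_harmonic_majorant`). A Vitali selection of
radii makes the total mass comparable to `r`, and the superposed potentials at `x₀` exceed the bound
on `v` (`add_sum_cappedLog_le`, `exists_sphere_subset_closure`). -/

/-! ### Laplacians and harmonic functions in the plane -/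

/-- The standard identification of the plane with `ℂ`. -/
def toComplex : Plane ≃ₗᵢ[ℝ] ℂ := Complex.orthonormalBasisOneI.repr.symm

theorem laplacian_comp_linearIsometryEquiv {E E' : Type*} [NormedAddCommGroup E]
    [InnerProductSpace ℝ E] [FiniteDimensional ℝ E] [NormedAddCommGroup E']
    [InnerProductSpace ℝ E'] [FiniteDimensional ℝ E'] (e : E ≃ₗᵢ[ℝ] E') (f : E' → ℝ) (x : E) :
    Δ (f ∘ e) x = Δ f (e x) := by
  rw [laplacian_eq_iteratedFDeriv_orthonormalBasis (f ∘ e) (stdOrthonormalBasis ℝ E),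
    laplacian_eq_iteratedFDeriv_orthonormalBasis f ((stdOrthonormalBasis ℝ E).map e)]
  refine Finset.sum_congr rfl fun i _ => ?_
  have := e.toContinuousLinearEquiv.iteratedFDerivWithin_comp_right f uniqueDiffOn_univ
    (Set.mem_univ (e x)) 2
  simp only [Set.preimage_univ, iteratedFDerivWithin_univ] at this
  erw [this]
  simp only [ContinuousMultilinearMap.compContinuousLinearMap_apply]
  congr 1
  ext j
  fin_cases j <;> simp

theorem HarmonicAt.comp_linearIsometryEquiv {E E' : Type*} [NormedAddCommGroup E]
    [InnerProductSpace ℝ E] [FiniteDimensional ℝ E] [NormedAddCommGroup E']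
    [InnerProductSpace ℝ E'] [FiniteDimensional ℝ E'] (e : E ≃ₗᵢ[ℝ] E') {f : E' → ℝ} {x : E}
    (h : HarmonicAt f (e x)) : HarmonicAt (f ∘ e) x := by
  refine ⟨h.1.comp x e.toContinuousLinearEquiv.contDiff.contDiffAt, ?_⟩
  have := e.continuous.continuousAt.eventually h.2
  filter_upwards [this] with z hz
  rw [laplacian_comp_linearIsometryEquiv, hz]; rfl

theorem harmonicAt_log_norm_sub {x y : Plane} (h : x ≠ y) :
    HarmonicAt (fun z : Plane => Real.log ‖z - y‖) x := by
  have h1 : HarmonicAt (fun w : ℂ => Real.log ‖w - toComplex y‖) (toComplex x) := by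
    apply AnalyticAt.harmonicAt_log_norm (f := fun w => w - toComplex y)
    · fun_prop
    · simpa [sub_eq_zero] using h
  convert HarmonicAt.comp_linearIsometryEquiv toComplex h1 using 2 with z
  simp [← map_sub]

theorem laplacian_norm_sub_sq (x y : Plane) : Δ (fun z : Plane => ‖z - y‖ ^ 2) x = 4 := by
  rw [laplacian_eq_iteratedFDeriv_orthonormalBasis _ (stdOrthonormalBasis ℝ Plane)]
  have hf : ∀ z : Plane, fderiv ℝ (fun z : Plane => ‖z - y‖ ^ 2) z = 2 • innerSL ℝ (z - y) := by
    intro z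
    have h := (hasStrictFDerivAt_norm_sq (z - y)).hasFDerivAt.comp z
      ((hasFDerivAt_id z).sub_const y)
    rw [ContinuousLinearMap.comp_id] at h
    exact h.fderiv
  have hf' : fderiv ℝ (fun z : Plane => ‖z - y‖ ^ 2) = fun z => 2 • innerSL ℝ (z - y) := funext hf
  have h2 : ∀ v : Plane, iteratedFDeriv ℝ 2 (fun z : Plane => ‖z - y‖ ^ 2) x ![v, v] = 2 * ‖v‖ ^ 2 := by
    intro v
    rw [iteratedFDeriv_two_apply, hf']
    have : HasFDerivAt (fun z : Plane => 2 • innerSL ℝ (z - y)) (2 • innerSL ℝ : Plane →L[ℝ] Plane →L[ℝ] ℝ) x := by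
      have h := ((2 • innerSL ℝ : Plane →L[ℝ] Plane →L[ℝ] ℝ).hasFDerivAt (x := x - y)).comp x
        ((hasFDerivAt_id x).sub_const y)
      rw [ContinuousLinearMap.comp_id] at h
      exact h
    rw [this.fderiv]
    simp only [smul_apply, nsmul_eq_mul, Nat.cast_ofNat, Matrix.cons_val_zero, Matrix.cons_val_one,
      Matrix.cons_val_fin_one]
    exact congrArg (2 * ·) (real_inner_self_eq_norm_sq v)
  simp [h2]
  norm_num

theorem contDiff_norm_sub_sq (y : Plane) : ContDiff ℝ 2 (fun z : Plane => ‖z - y‖ ^ 2) :=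
  (contDiff_id.sub contDiff_const).norm_sq ℝ

theorem contDiffAt_sub_mul_norm_sub_sq {φ : Plane → ℝ} {x : Plane} (hφ : ContDiffAt ℝ 2 φ x)
    (ε : ℝ) (y : Plane) : ContDiffAt ℝ 2 (fun z => φ z - ε * ‖z - y‖ ^ 2) x :=
  hφ.sub (contDiffAt_const.mul (contDiff_norm_sub_sq y).contDiffAt)

theorem laplacian_sub_mul_norm_sub_sq {φ : Plane → ℝ} {x : Plane} (hφ : ContDiffAt ℝ 2 φ x)
    (ε : ℝ) (y : Plane) : Δ (fun z => φ z - ε * ‖z - y‖ ^ 2) x = Δ φ x - 4 * ε := by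
  have hq : ContDiffAt ℝ 2 (ε • fun z : Plane => ‖z - y‖ ^ 2) x :=
    contDiffAt_const.smul (contDiff_norm_sub_sq y).contDiffAt
  change Δ (φ - ε • fun z : Plane => ‖z - y‖ ^ 2) x = _
  rw [hφ.laplacian_sub hq, laplacian_smul _ (contDiff_norm_sub_sq y).contDiffAt,
    laplacian_norm_sub_sq, smul_eq_mul, mul_comm]

/-! ### Maximum principle and viscosity comparison -/

/-- A positive second derivative along `v` would make the maximum also a local minimum on that line;
the restriction would be locally constant, with second derivative zero. -/
theorem iteratedFDeriv_two_nonpos_of_isLocalMax {f : Plane → ℝ} {x : Plane}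
    (hf : ContDiffAt ℝ 2 f x) (hx : IsLocalMax f x) (v : Plane) :
    iteratedFDeriv ℝ 2 f x ![v, v] ≤ 0 := by
  by_contra! hpos
  rw [iteratedFDeriv_two_apply] at hpos
  simp only [Matrix.cons_val_zero, Matrix.cons_val_one, Matrix.cons_val_fin_one] at hpos
  set ℓ : ℝ → Plane := fun t => x + t • v with hℓ
  have hℓd : ∀ t, HasDerivAt ℓ v t := fun t => by
    have h := ((hasDerivAt_id t).smul_const v).const_add x
    rw [one_smul] at h
    exact h
  have hℓc : ContinuousAt ℓ 0 := (hℓd 0).continuousAt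
  have hℓ0 : ℓ 0 = x := by simp [hℓ]
  have hdiff : ∀ᶠ z in 𝓝 x, DifferentiableAt ℝ f z := by
    filter_upwards [hf.eventually (by simp)] with z hz using hz.differentiableAt (by simp)
  have hd1 : deriv (f ∘ ℓ) =ᶠ[𝓝 (0 : ℝ)] fun t => fderiv ℝ f (ℓ t) v := by
    have := hℓc.eventually (hℓ0.symm ▸ hdiff)
    filter_upwards [this] with t ht
    exact (ht.hasFDerivAt.comp_hasDerivAt t (hℓd t)).deriv
  have hfd : DifferentiableAt ℝ (fderiv ℝ f) x :=
    (hf.fderiv_right (m := 1) (by norm_num)).differentiableAt (by simp)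
  have hd2 : deriv (deriv (f ∘ ℓ)) 0 = fderiv ℝ (fderiv ℝ f) x v v := by
    rw [hd1.deriv_eq]
    have h1 : HasFDerivAt (fderiv ℝ f) (fderiv ℝ (fderiv ℝ f) x) (ℓ 0) := by
      rw [hℓ0]; exact hfd.hasFDerivAt
    have := (h1.comp_hasDerivAt (0 : ℝ) (hℓd 0)).clm_apply (hasDerivAt_const (0:ℝ) v)
    simpa using this.deriv
  have hmax : IsLocalMax (f ∘ ℓ) 0 := by
    have := hℓc.eventually (hℓ0.symm ▸ hx)
    filter_upwards [this] with t ht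
    simpa [hℓ0] using ht
  have hc : ContinuousAt (f ∘ ℓ) 0 :=
    ContinuousAt.comp (by rw [hℓ0]; exact hf.continuousAt) hℓc
  have hmin : IsLocalMin (f ∘ ℓ) 0 :=
    isLocalMin_of_deriv_deriv_pos (by rw [hd2]; exact hpos) hmax.deriv_eq_zero hc
  have hconst : f ∘ ℓ =ᶠ[𝓝 0] fun _ => (f ∘ ℓ) 0 := by
    filter_upwards [hmax, hmin] with t h1 h2 using le_antisymm h1 h2
  have : deriv (deriv (f ∘ ℓ)) 0 = 0 := by
    have h1 : deriv (f ∘ ℓ) =ᶠ[𝓝 0] fun _ => 0 := by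
      filter_upwards [hconst.eventuallyEq_nhds] with t ht
      rw [ht.deriv_eq]; simp
    rw [h1.deriv_eq]; simp
  rw [hd2] at this
  exact hpos.ne' this

theorem laplacian_nonpos_of_isLocalMax {f : Plane → ℝ} {x : Plane}
    (hf : ContDiffAt ℝ 2 f x) (hx : IsLocalMax f x) : Δ f x ≤ 0 := by
  rw [laplacian_eq_iteratedFDeriv_orthonormalBasis _ (stdOrthonormalBasis ℝ Plane)]
  exact Finset.sum_nonpos fun i _ => iteratedFDeriv_two_nonpos_of_isLocalMax hf hx _

theorem laplacian_nonneg_of_isLocalMin {f : Plane → ℝ} {x : Plane}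
    (hf : ContDiffAt ℝ 2 f x) (hx : IsLocalMin f x) : 0 ≤ Δ f x := by
  have := laplacian_nonpos_of_isLocalMax hf.neg hx.neg
  change Δ (-f) x ≤ 0 at this
  rw [laplacian_neg] at this
  simpa using this

/-- A `C²` function with nonnegative Laplacian is subharmonic in the viscosity sense. -/
theorem viscositySubharmonicOn_of_laplacian_nonneg {f : Plane → ℝ} {U : Set Plane}
    (hf : ∀ x ∈ U, ContDiffAt ℝ 2 f x) (hΔ : ∀ x ∈ U, 0 ≤ Δ f x) : ViscositySubharmonicOn f U := by
  intro x hx φ hφ hmax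
  have h := laplacian_nonpos_of_isLocalMax ((hf x hx).sub hφ) hmax
  change Δ (f - φ) x ≤ 0 at h
  rw [(hf x hx).laplacian_sub hφ] at h
  linarith [hΔ x hx]

/-- A nonnegative function that is subharmonic where it is positive is subharmonic. -/
theorem ViscositySubharmonicOn.of_nonneg {v : Plane → ℝ} {U : Set Plane} (hU : IsOpen U)
    (hv : ∀ x ∈ U, 0 ≤ v x) (h : ViscositySubharmonicOn v {x ∈ U | 0 < v x}) :
    ViscositySubharmonicOn v U := by
  intro x hx φ hφ hmax
  rcases (hv x hx).lt_or_eq with h0 | h0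
  · exact h x ⟨hx, h0⟩ φ hφ hmax
  -- At a zero of `v`, touching from above gives `φ - φ x ≥ v ≥ 0` nearby, so `φ` itself has a local
  -- minimum.
  · refine laplacian_nonneg_of_isLocalMin hφ ?_
    filter_upwards [hmax, hU.mem_nhds hx] with z hz hzU
    have := hv z hzU
    linarith

theorem ViscositySubharmonicOn.mono {v : Plane → ℝ} {U V : Set Plane}
    (h : ViscositySubharmonicOn v U) (hVU : V ⊆ U) : ViscositySubharmonicOn v V :=
  fun x hx => h x (hVU hx)

/-- Comparison principle. -/
theorem ViscositySubharmonicOn.le_of_le_boundary {v φ : Plane → ℝ} {K U : Set Plane}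
    (hK : IsCompact K) (hU : IsOpen U) (hUK : U ⊆ K) (hv : ContinuousOn v K)
    (hsub : ViscositySubharmonicOn v U) (hφ : ContinuousOn φ K)
    (hφ2 : ∀ x ∈ U, ContDiffAt ℝ 2 φ x) (hΔ : ∀ x ∈ U, Δ φ x ≤ 0)
    (hbd : ∀ x ∈ K, x ∉ U → v x ≤ φ x) : ∀ x ∈ K, v x ≤ φ x := by
  intro z hz
  by_contra! hlt
  obtain ⟨C, hC⟩ := hK.isBounded.exists_norm_le
  have hC0 : 0 ≤ C := (norm_nonneg z).trans (hC z hz)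
  -- The penalty `ε * ‖x‖ ^ 2` makes the Laplacian inequality strict, yet is less than `v z - φ z`
  -- on `K`, so the maximum point remains in `U`.
  set ε : ℝ := (v z - φ z) / (2 * (C ^ 2 + 1)) with hε
  have hε0 : 0 < ε := div_pos (by linarith) (by positivity)
  have hεC : ε * (2 * (C ^ 2 + 1)) = v z - φ z := by rw [hε]; field_simp
  obtain ⟨x, hxK, hx⟩ := hK.exists_isMaxOn ⟨z, hz⟩
    (f := fun x => v x - (φ x - ε * ‖x - 0‖ ^ 2)) (by fun_prop)
  have hxz := hx hz
  simp only [Set.mem_ofPred_eq, sub_zero] at hxz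
  have hxC : ‖x‖ ^ 2 ≤ C ^ 2 := pow_le_pow_left₀ (norm_nonneg x) (hC x hxK) 2
  have hz0 : 0 ≤ ε * ‖z‖ ^ 2 := by positivity
  have hx0 : ε * ‖x‖ ^ 2 ≤ ε * C ^ 2 := by gcongr
  have hxU : x ∈ U := by
    by_contra hxU
    have := hbd x hxK hxU
    nlinarith
  have h1 := hsub x hxU _ (contDiffAt_sub_mul_norm_sub_sq (hφ2 x hxU) ε 0)
    (hx.isLocalMax (mem_of_superset (hU.mem_nhds hxU) hUK))
  rw [laplacian_sub_mul_norm_sub_sq (hφ2 x hxU)] at h1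
  linarith [hΔ x hxU]

/-! ### Harnack's inequality and the Dirichlet problem on discs -/

/-- **Harnack's inequality** for discs. -/
theorem harnack_complex {Φ : ℂ → ℝ} {c w : ℂ} {R : ℝ} (hΦ : HarmonicOnNhd Φ (closedBall c R))
    (h0 : ∀ z ∈ sphere c R, 0 ≤ Φ z) (hw : w ∈ ball c R) :
    (R - ‖w - c‖) / (R + ‖w - c‖) * Φ c ≤ Φ w ∧
      Φ w ≤ (R + ‖w - c‖) / (R - ‖w - c‖) * Φ c := by
  have hR : 0 < R := pos_of_mem_ball hw
  have hcont : ContinuousOn Φ (sphere c |R|) := by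
    rw [abs_of_pos hR]; exact hΦ.continuousOn.mono sphere_subset_closedBall
  have hint : CircleIntegrable Φ c R := hcont.circleIntegrable'
  have hker : ContinuousOn (Complex.re ∘ herglotzRieszKernel c w) (sphere c |R|) :=
    Complex.continuous_re.comp_continuousOn (continuousOn_herglotzRieszKernel_sphere hw)
  have hint' : CircleIntegrable ((Complex.re ∘ herglotzRieszKernel c w) • Φ) c R :=
    (hker.smul hcont).circleIntegrable'
  have hc : Real.circleAverage Φ c R = Φ c :=
    InnerProductSpace.HarmonicOnNhd.circleAverage_eq (by rwa [abs_of_pos hR])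
  -- Poisson's formula at `w` and the mean value property at `c`; the two-sided bound on the kernel
  -- does the rest.
  rw [← hΦ.circleAverage_re_herglotzRieszKernel_smul hw, ← hc, ← smul_eq_mul, ← smul_eq_mul,
    ← Real.circleAverage_smul, ← Real.circleAverage_smul]
  constructor
  · refine Real.circleAverage_mono (hcont.const_smul _).circleIntegrable' hint' fun z hz => ?_
    rw [abs_of_pos hR] at hz
    exact mul_le_mul_of_nonneg_right (le_re_herglotzRieszKernel hz hw) (h0 z hz)
  · refine Real.circleAverage_mono hint' (hcont.const_smul _).circleIntegrable' fun z hz => ?_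
    rw [abs_of_pos hR] at hz
    exact mul_le_mul_of_nonneg_right (re_herglotzRieszKernel_le hz hw) (h0 z hz)

/-- **Harnack's inequality** for discs in the plane. -/
theorem harnack {Φ : Plane → ℝ} {c w : Plane} {R : ℝ} (hΦ : HarmonicOnNhd Φ (closedBall c R))
    (h0 : ∀ z ∈ sphere c R, 0 ≤ Φ z) (hw : w ∈ ball c R) :
    (R - ‖w - c‖) / (R + ‖w - c‖) * Φ c ≤ Φ w ∧
      Φ w ≤ (R + ‖w - c‖) / (R - ‖w - c‖) * Φ c := by
  have hd : ∀ z : ℂ, dist z (toComplex c) = dist (toComplex.symm z) c := fun z => by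
    rw [← toComplex.dist_map (toComplex.symm z) c]; simp
  have := harnack_complex (Φ := Φ ∘ toComplex.symm) (c := toComplex c) (w := toComplex w) (R := R)
    (fun z hz => HarmonicAt.comp_linearIsometryEquiv toComplex.symm
      (hΦ _ (by rw [mem_closedBall] at hz ⊢; rwa [← hd])))
    (fun z hz => h0 _ (by rw [mem_sphere] at hz ⊢; rwa [← hd]))
    (by rw [mem_ball] at hw ⊢; simpa using hw)
  simpa [← map_sub] using this

/-- The maximum principle on discs. -/
theorem le_of_le_sphere {Φ : Plane → ℝ} {c : Plane} {R a : ℝ}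
    (hcont : ContinuousOn Φ (closedBall c R)) (hΦ : ViscositySubharmonicOn Φ (ball c R))
    (h0 : ∀ z ∈ sphere c R, Φ z ≤ a) : ∀ w ∈ closedBall c R, Φ w ≤ a :=
  hΦ.le_of_le_boundary (φ := fun _ => a) (isCompact_closedBall c R) isOpen_ball
    ball_subset_closedBall hcont continuousOn_const (fun _ _ => contDiffAt_const)
    (fun _ _ => by simp)
    fun x hx hx' => h0 x (le_antisymm (mem_closedBall.1 hx) (not_lt.1 hx'))

theorem viscositySubharmonicOn_of_harmonicOnNhd {Φ : Plane → ℝ} {U : Set Plane}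
    (hΦ : HarmonicOnNhd Φ U) : ViscositySubharmonicOn Φ U :=
  viscositySubharmonicOn_of_laplacian_nonneg (fun x hx => (hΦ x hx).1)
    fun x hx => (hΦ x hx).2.eq_of_nhds.ge

/-- Trigonometric polynomials are boundary values of `F + conj G` with `F` and `G` entire. -/
theorem exists_entire_of_mem_span_fourier {T : ℝ} {q : C(AddCircle T, ℂ)}
    (hq : q ∈ Submodule.span ℂ (Set.range (@fourier T))) :
    ∃ F G : ℂ → ℂ, Differentiable ℂ F ∧ Differentiable ℂ G ∧
      ∀ θ, q θ = F (AddCircle.toCircle θ) + starRingEnd ℂ (G (AddCircle.toCircle θ)) := by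
  induction hq using Submodule.span_induction with
  | mem q hq =>
    obtain ⟨n, rfl⟩ := hq
    have hnat : ∀ (k : ℕ) (θ : AddCircle T), fourier (k : ℤ) θ = (AddCircle.toCircle θ : ℂ) ^ k :=
      fun k θ => by
        rw [fourier_apply, natCast_zsmul, AddCircle.toCircle_nsmul, Circle.coe_pow]
    obtain ⟨k, rfl | rfl⟩ := n.eq_nat_or_neg
    · exact ⟨fun z => z ^ k, fun _ => 0, by fun_prop, by fun_prop, fun θ => by simp [hnat]⟩
    · exact ⟨fun _ => 0, fun z => z ^ k, by fun_prop, by fun_prop, fun θ => by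
        rw [fourier_neg, hnat, zero_add]⟩
  | zero => exact ⟨fun _ => 0, fun _ => 0, by fun_prop, by fun_prop, by simp⟩
  | add p q _ _ hp hq =>
    obtain ⟨F, G, hF, hG, h⟩ := hp
    obtain ⟨F', G', hF', hG', h'⟩ := hq
    refine ⟨F + F', G + G', hF.add hF', hG.add hG', fun θ => ?_⟩
    simp only [ContinuousMap.add_apply, h, h', Pi.add_apply, map_add]
    ring
  | smul a p _ hp =>
    obtain ⟨F, G, hF, hG, h⟩ := hp
    refine ⟨a • F, (starRingEnd ℂ a) • G, hF.const_smul _, hG.const_smul _, fun θ => ?_⟩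
    simp [h, mul_add]

/-- Continuous functions on a circle are uniformly approximated by harmonic functions on the
plane. -/
theorem exists_harmonic_near_on_sphere {v : Plane → ℝ} {y : Plane} {R : ℝ} (hR : 0 < R)
    (hv : ContinuousOn v (sphere y R)) {ε : ℝ} (hε : 0 < ε) :
    ∃ Φ : Plane → ℝ, HarmonicOnNhd Φ Set.univ ∧ ∀ x ∈ sphere y R, |Φ x - v x| ≤ ε := by
  have : Fact (0 < 2 * Real.pi) := ⟨Real.two_pi_pos⟩
  set γ : AddCircle (2 * Real.pi) → Plane :=
    fun θ => y + R • toComplex.symm (AddCircle.toCircle θ : ℂ) with hγ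
  have hγc : Continuous γ := by
    have := AddCircle.continuous_toCircle (T := 2 * Real.pi)
    fun_prop
  have hγs : ∀ θ, γ θ ∈ sphere y R := fun θ => by
    rw [mem_sphere, dist_eq_norm]
    simp [hγ, norm_smul, abs_of_pos hR, Circle.norm_coe]
  set q : C(AddCircle (2 * Real.pi), ℂ) :=
    ⟨fun θ => (v (γ θ) : ℂ), Complex.continuous_ofReal.comp (hv.comp_continuous hγc hγs)⟩
  have hq : q ∈ (Submodule.span ℂ (Set.range (@fourier (2 * Real.pi)))).topologicalClosure := by
    rw [span_fourier_closure_eq_top]; trivial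
  obtain ⟨P, hP, hPq⟩ := Metric.mem_closure_iff.1 hq ε hε
  obtain ⟨F, G, hF, hG, hFG⟩ := exists_entire_of_mem_span_fourier hP
  -- The data are real, so only real parts matter, and `conj G` has the same real part as `G`: the
  -- holomorphic `F + G` serves.
  refine ⟨(fun z : ℂ => (F ((R : ℂ)⁻¹ * (z - toComplex y)) + G ((R : ℂ)⁻¹ * (z - toComplex y))).re)
    ∘ toComplex, fun x _ => HarmonicAt.comp_linearIsometryEquiv _ ?_, fun x hx => ?_⟩
  · refine AnalyticAt.harmonicAt_re (f := fun z : ℂ =>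
      F ((R : ℂ)⁻¹ * (z - toComplex y)) + G ((R : ℂ)⁻¹ * (z - toComplex y))) ?_
    refine Differentiable.analyticAt (f := fun z : ℂ =>
      F ((R : ℂ)⁻¹ * (z - toComplex y)) + G ((R : ℂ)⁻¹ * (z - toComplex y))) ?_ _
    fun_prop
  · set ζ : ℂ := (R : ℂ)⁻¹ * toComplex (x - y) with hζ
    have hζ1 : ‖ζ‖ = 1 := by
      rw [mem_sphere, dist_eq_norm] at hx
      simp [hζ, hx, abs_of_pos hR, hR.ne', -map_sub]
    set θ : AddCircle (2 * Real.pi) := ((ζ.arg : ℝ) : AddCircle (2 * Real.pi))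
    have hθ : (AddCircle.toCircle θ : ℂ) = ζ := by
      have h1 : (AddCircle.toCircle θ : ℂ) = Complex.exp (ζ.arg * Complex.I) := by
        simp [θ, AddCircle.toCircle_apply_mk, Circle.coe_exp, Real.pi_ne_zero]
      rw [h1]
      simpa [hζ1] using Complex.norm_mul_exp_arg_mul_I ζ
    have hγθ : γ θ = x := by
      simp only [hγ, hθ, hζ]
      rw [← Complex.ofReal_inv, ← Complex.real_smul, map_smul, toComplex.symm_apply_apply, smul_smul,
        mul_inv_cancel₀ hR.ne', one_smul, add_sub_cancel]
    have h1 : dist (q θ) (P θ) ≤ dist q P := ContinuousMap.dist_apply_le_dist θ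
    rw [dist_comm, dist_eq_norm] at h1
    have h2 : |((P θ - q θ) : ℂ).re| ≤ ε := (Complex.abs_re_le_norm _).trans (h1.trans hPq.le)
    rw [hFG θ, hθ] at h2
    simpa [q, hγθ, hζ] using h2

/-- The Dirichlet problem on a disc: the solution is a uniform limit of harmonic functions. -/
theorem exists_dirichlet {v : Plane → ℝ} {y : Plane} {R : ℝ} (hR : 0 < R)
    (hv : ContinuousOn v (sphere y R)) :
    ∃ (H : Plane → ℝ) (Φ : ℕ → Plane → ℝ), ContinuousOn H (closedBall y R) ∧
      (∀ x ∈ sphere y R, H x = v x) ∧ (∀ n, HarmonicOnNhd (Φ n) Set.univ) ∧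
      TendstoUniformlyOn Φ H atTop (closedBall y R) := by
  choose Φ hΦ hΦv using fun n : ℕ =>
    exists_harmonic_near_on_sphere hR hv (ε := 1 / ((n : ℝ) + 1)) (by positivity)
  -- By the maximum principle, closeness on the circle propagates to the disc, so the approximants
  -- are uniformly Cauchy there.
  have hle : ∀ m n, ∀ x ∈ closedBall y R,
      Φ m x - Φ n x ≤ 1 / ((m : ℝ) + 1) + 1 / ((n : ℝ) + 1) := by
    intro m n
    have hh : HarmonicOnNhd (Φ m - Φ n) Set.univ := (hΦ m).sub (hΦ n)
    refine le_of_le_sphere (Φ := Φ m - Φ n) (hh.continuousOn.mono (Set.subset_univ _))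
      (viscositySubharmonicOn_of_harmonicOnNhd (hh.mono (Set.subset_univ _))) fun z hz => ?_
    have h1 := abs_le.1 (hΦv m z hz)
    have h2 := abs_le.1 (hΦv n z hz)
    simp only [Pi.sub_apply]
    linarith [h1.2, h2.1]
  have hlim : Tendsto (fun n : ℕ => 1 / ((n : ℝ) + 1)) atTop (𝓝 0) :=
    tendsto_one_div_add_atTop_nhds_zero_nat
  have hcau : UniformCauchySeqOn Φ atTop (closedBall y R) := by
    rw [Metric.uniformCauchySeqOn_iff]
    intro ε hε
    obtain ⟨N, hN⟩ := eventually_atTop.1 (hlim.eventually (gt_mem_nhds (half_pos hε)))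
    refine ⟨N, fun m hm n hn x hx => ?_⟩
    rw [Real.dist_eq, abs_lt]
    have := hN m hm
    have := hN n hn
    constructor <;> linarith [hle m n x hx, hle n m x hx]
  have hpt : ∀ x, ∃ a, x ∈ closedBall y R → Tendsto (fun n => Φ n x) atTop (𝓝 a) := fun x => by
    by_cases hx : x ∈ closedBall y R
    · obtain ⟨a, ha⟩ := cauchySeq_tendsto_of_complete (hcau.cauchySeq hx)
      exact ⟨a, fun _ => ha⟩
    · exact ⟨0, fun h => absurd h hx⟩
  choose H hH using hpt
  have hun := hcau.tendstoUniformlyOn_of_tendsto hH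
  refine ⟨H, Φ, hun.continuousOn (Frequently.of_forall fun n =>
    (hΦ n).continuousOn.mono (Set.subset_univ _)), fun x hx => ?_, hΦ, hun⟩
  have h1 := hH x (sphere_subset_closedBall hx)
  refine tendsto_nhds_unique h1 ?_
  rw [tendsto_iff_dist_tendsto_zero]
  exact squeeze_zero (fun _ => dist_nonneg) (fun n => hΦv n x hx) hlim

/-- Viscosity subharmonicity passes to locally uniform limits. -/
theorem viscositySubharmonicOn_of_tendstoUniformlyOn {H : Plane → ℝ} {Φ : ℕ → Plane → ℝ}
    {U : Set Plane} (hU : IsOpen U) (hc : ∀ n, ContinuousOn (Φ n) U)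
    (hΦ : ∀ n, ViscositySubharmonicOn (Φ n) U) (hlim : TendstoUniformlyOn Φ H atTop U) :
    ViscositySubharmonicOn H U := by
  intro x hx φ hφ hmax
  by_contra! hneg
  have hΔc : ContinuousAt (Δ φ) x := by
    rw [laplacian_eq_iteratedFDeriv_orthonormalBasis _ (stdOrthonormalBasis ℝ Plane)]
    exact tendsto_finsetSum _ fun i _ =>
      (ContinuousMultilinearMap.apply ℝ (fun _ : Fin 2 => Plane) ℝ _).continuous.continuousAt.comp
        (hφ.continuousAt_iteratedFDeriv (k := 2) le_rfl)
  -- Adding `ε * ‖z - x‖ ^ 2` to `φ` raises its Laplacian by `4 * ε`, leaving it negative near `x`.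
  -- On the circle of radius `d` it costs `ε * d ^ 2`, more than the uniform error can recover, so
  -- the maximum is interior.
  set ε : ℝ := -(Δ φ x) / 8 with hε
  have hε0 : 0 < ε := by rw [hε]; linarith
  have hev : ∀ᶠ z in 𝓝 x, z ∈ U ∧ H z - φ z ≤ H x - φ x ∧ Δ φ z < -4 * ε ∧ ContDiffAt ℝ 2 φ z :=
    (hU.eventually_mem hx).and <| hmax.and <|
      (hΔc.eventually (gt_mem_nhds (by rw [hε]; linarith))).and (hφ.eventually (by simp))
  obtain ⟨d, hd, hball⟩ := Metric.nhds_basis_closedBall.eventually_iff.1 hev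
  obtain ⟨n, hn⟩ := ((Metric.tendstoUniformlyOn_iff.1 hlim (ε * d ^ 2 / 2) (by positivity))).exists
  have hφc : ContinuousOn φ (closedBall x d) := fun z hz =>
    (hball hz).2.2.2.continuousAt.continuousWithinAt
  obtain ⟨z, hz, hzmax⟩ := (isCompact_closedBall x d).exists_isMaxOn
    ⟨x, mem_closedBall_self hd.le⟩ (f := fun z => Φ n z - (φ z - (-ε) * ‖z - x‖ ^ 2))
    (((hc n).mono fun z hz => (hball hz).1).sub (hφc.sub (by fun_prop)))
  have hxz := hzmax (mem_closedBall_self hd.le)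
  simp only [Set.mem_ofPred_eq, sub_self, norm_zero] at hxz
  have h1 := abs_lt.1 (hn x hx)
  have h2 := abs_lt.1 (hn z (hball hz).1)
  have hzb : z ∈ ball x d := by
    rw [mem_ball]
    refine lt_of_le_of_ne hz fun h => ?_
    rw [dist_eq_norm] at h
    rw [h] at hxz
    have := (hball hz).2.1
    linarith [h1.1, h1.2, h2.1, h2.2]
  have h3 := hΦ n z (hball hz).1 _ (contDiffAt_sub_mul_norm_sub_sq (hball hz).2.2.2 (-ε) x)
    (hzmax.isLocalMax (mem_of_superset (isOpen_ball.mem_nhds hzb) ball_subset_closedBall))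
  rw [laplacian_sub_mul_norm_sub_sq (hball hz).2.2.2] at h3
  linarith [(hball hz).2.2.1]

/-! ### Growth of subsolutions next to exterior tangent balls -/

theorem harmonicAt_const_mul_log {x y : Plane} (h : x ≠ y) (a : ℝ) :
    HarmonicAt (fun z : Plane => a * Real.log ‖z - y‖) x :=
  HarmonicAt.const_smul (c := a) (harmonicAt_log_norm_sub h)

/-- Comparison on an annulus with a harmonic function plus a logarithm. -/
theorem ViscositySubharmonicOn.le_add_log_of_annulus {v Φ : Plane → ℝ} {y : Plane} {s S a : ℝ}
    (hs : 0 < s) (hv : ContinuousOn v (closedBall y S)) (hsub : ViscositySubharmonicOn v (ball y S))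
    (hΦ : HarmonicOnNhd Φ Set.univ)
    (h₁ : ∀ x, ‖x - y‖ = s → v x ≤ Φ x + a * Real.log ‖x - y‖)
    (h₂ : ∀ x, ‖x - y‖ = S → v x ≤ Φ x + a * Real.log ‖x - y‖) :
    ∀ x, s ≤ ‖x - y‖ → ‖x - y‖ ≤ S → v x ≤ Φ x + a * Real.log ‖x - y‖ := by
  have hne : ∀ x, s ≤ ‖x - y‖ → x ≠ y := by
    rintro x hx rfl
    simp at hx
    linarith
  have hharm : ∀ x, s ≤ ‖x - y‖ → HarmonicAt (fun x => Φ x + a * Real.log ‖x - y‖) x := fun x hx =>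
    HarmonicAt.add (hΦ x trivial) (harmonicAt_const_mul_log (hne x hx) a)
  have hnc : Continuous fun x : Plane => ‖x - y‖ := by fun_prop
  have hKc : IsClosed {x : Plane | s ≤ ‖x - y‖} := isClosed_le continuous_const hnc
  have hK : closedBall y S ∩ {x : Plane | s ≤ ‖x - y‖} ⊆ closedBall y S := Set.inter_subset_left
  intro x hx1 hx2
  refine ViscositySubharmonicOn.le_of_le_boundary
    (K := closedBall y S ∩ {x | s ≤ ‖x - y‖}) (U := ball y S ∩ {x | s < ‖x - y‖})
    (φ := fun x => Φ x + a * Real.log ‖x - y‖)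
    ((isCompact_closedBall y S).inter_right hKc) (isOpen_ball.inter (isOpen_lt continuous_const hnc))
    (Set.inter_subset_inter ball_subset_closedBall fun z (h : s < ‖z - y‖) => h.le) (hv.mono hK)
    (hsub.mono Set.inter_subset_left) (fun z hz => (hharm z hz.2).1.continuousAt.continuousWithinAt)
    (fun z hz => (hharm z (le_of_lt hz.2)).1) (fun z hz => (hharm z (le_of_lt hz.2)).2.eq_of_nhds.le)
    (fun z hz hz' => ?_) x ⟨by rwa [mem_closedBall, dist_eq_norm], hx1⟩
  rcases (show s ≤ ‖z - y‖ from hz.2).eq_or_lt with h | h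
  · exact h₁ z h.symm
  · refine h₂ z (le_antisymm (by simpa [dist_eq_norm] using hz.1) (not_lt.1 fun h' => hz' ⟨?_, h⟩))
    rwa [mem_ball, dist_eq_norm]

theorem IsSubsolution.viscositySubharmonicOn_of_disjoint {D : Set Plane} {f g v : Plane → ℝ}
    (hv : IsSubsolution D f g v) {U : Set Plane} (hU : IsOpen U) (hUD : Disjoint U D) :
    ViscositySubharmonicOn v U :=
  ViscositySubharmonicOn.of_nonneg hU (fun x hx => hv.nonneg x (hUD.notMem_of_mem_left hx))
    (hv.subharmonic.mono fun _ hx => ⟨⟨hUD.notMem_of_mem_left hx.1, hx.2⟩,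
      (hUD.closure_right hU).notMem_of_mem_left hx.1⟩)

theorem IsSubsolution.continuousOn_of_disjoint {D : Set Plane} {f g v : Plane → ℝ}
    (hv : IsSubsolution D f g v) {K : Set Plane} (hK : Disjoint K D) : ContinuousOn v K :=
  hv.continuousOn.mono fun _ hx => hK.notMem_of_mem_left hx

/-- `v` vanishes on the closure of a ball that does not meet `Ω(v)`. -/
theorem IsSubsolution.eq_zero_of_disjoint {D : Set Plane} {f g v : Plane → ℝ}
    (hv : IsSubsolution D f g v) {y : Plane} {s : ℝ} (hs : 0 < s)
    (hD : Disjoint (closedBall y s) D) (hy : Disjoint (ball y s) (posSet D v)) :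
    ∀ x ∈ closedBall y s, v x = 0 := by
  intro x hx
  refine le_antisymm ?_ (hv.nonneg x (hD.notMem_of_mem_left hx))
  have hcl := (hv.continuousOn_of_disjoint hD).preimage_isClosed_of_isClosed isClosed_closedBall
    (isClosed_Iic (a := (0 : ℝ)))
  have hsub : ball y s ⊆ closedBall y s ∩ v ⁻¹' Set.Iic 0 := fun z hz =>
    ⟨ball_subset_closedBall hz, not_lt.1 fun h => hy.notMem_of_mem_left hz
      ⟨hD.notMem_of_mem_left (ball_subset_closedBall hz), h⟩⟩
  have := closure_minimal hsub hcl
  rw [closure_ball y hs.ne'] at this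
  exact (this hx).2

/-- Shows that a first contact of a moving zero ball with `closure W` is a genuine tangency, to
which the free boundary condition applies. -/
theorem frontier_of_disjoint_ball {W : Set Plane} {x y : Plane} {s : ℝ} (hs : 0 < s)
    (hW : Disjoint (ball y s) W) (hx : x ∈ closedBall y s) (hxW : x ∈ closure W) :
    x ∈ frontier W ∧ dist x y = s := by
  refine ⟨⟨hxW, fun hint => ?_⟩, le_antisymm hx (not_lt.1 fun h => ?_)⟩
  · rw [← closure_ball y hs.ne'] at hx
    obtain ⟨z, hz, hz'⟩ := mem_closure_iff.1 hx _ isOpen_interior hint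
    exact hW.notMem_of_mem_left hz' (interior_subset hz)
  · exact (hW.closure_right isOpen_ball).notMem_of_mem_left (mem_ball.2 h) hxW

/-- Next to an exterior tangent ball of radius `s`, a subsolution grows at least linearly in `s`. -/
theorem IsSubsolution.exists_lt_of_tangent {D : Set Plane} {f g v : Plane → ℝ}
    (hv : IsSubsolution D f g v) {lam : ℝ} (hlam : 0 < lam) {x₁ y : Plane} {s : ℝ}
    (hf : lam < f x₁) (hx₁ : x₁ ∈ frontier (posSet D v))
    (htan : IsExteriorTangentBall (posSet D v) x₁ y s) (hD : Disjoint (closedBall y (2 * s)) D) :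
    ∃ x ∈ closedBall y (2 * s), √lam * Real.log 2 / 2 * s < v x := by
  by_contra! hle
  obtain ⟨hs, hdis, hdist⟩ := id htan
  have hlog2 : 0 < Real.log 2 := Real.log_pos one_lt_two
  have hsl : 0 < √lam := Real.sqrt_pos.2 hlam
  have hzero := hv.eq_zero_of_disjoint hs (hD.mono_left (closedBall_subset_closedBall (by linarith)))
    hdis
  -- If `v` were small, it would lie below `α * s * log (‖x - y‖ / s)`, which has slope `α` on the
  -- circle of radius `s` and equals the assumed bound on the circle of radius `2 * s`. The slope
  -- `√lam / 2` violates the free boundary condition.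
  set α : ℝ := √lam / 2 with hα
  have hα0 : 0 < α := by positivity
  have hlog : ∀ x, s ≤ ‖x - y‖ → ‖x - y‖ ≤ 2 * s →
      v x ≤ -(α * s * Real.log s) + α * s * Real.log ‖x - y‖ := by
    refine ViscositySubharmonicOn.le_add_log_of_annulus hs (hv.continuousOn_of_disjoint hD)
      (hv.viscositySubharmonicOn_of_disjoint isOpen_ball (hD.mono_left ball_subset_closedBall))
      (Φ := fun _ => -(α * s * Real.log s)) (harmonicOnNhd_const _) (fun x hx => ?_) fun x hx => ?_
    · rw [hzero x (by rw [mem_closedBall, dist_eq_norm, hx]), hx]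
      simp
    · rw [hx, Real.log_mul two_ne_zero hs.ne']
      refine (hle x (by rw [mem_closedBall, dist_eq_norm, hx])).trans (le_of_eq ?_)
      rw [hα]; ring
  have hbelow : BelowPlaneAt D v x₁ (s⁻¹ • (x₁ - y)) α := by
    intro ε hε
    have hmem : ball x₁ (min s (ε * (2 * s) / α)) ∈ 𝓝[Dᶜ] x₁ :=
      mem_nhdsWithin_of_mem_nhds (ball_mem_nhds _ (by positivity))
    filter_upwards [hmem] with x hx
    rw [mem_ball, dist_eq_norm, lt_min_iff] at hx
    obtain ⟨hx1, hx2⟩ := hx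
    rw [dist_eq_norm] at hdist
    have hm0 : 0 ≤ α * max (inner ℝ (x - x₁) (s⁻¹ • (x₁ - y))) 0 := by positivity
    rcases le_total ‖x - y‖ s with h | h
    · rw [hzero x (by rwa [mem_closedBall, dist_eq_norm])]
      positivity
    · have h2s : ‖x - y‖ ≤ 2 * s := by
        calc ‖x - y‖ = ‖(x - x₁) + (x₁ - y)‖ := by congr 1; abel
          _ ≤ ‖x - x₁‖ + ‖x₁ - y‖ := norm_add_le _ _
          _ ≤ 2 * s := by linarith
      have h1 := hlog x h h2s
      have hpos : 0 < ‖x - y‖ := hs.trans_le h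
      have h2 : Real.log (‖x - y‖ / s) ≤ ‖x - y‖ / s - 1 :=
        Real.log_le_sub_one_of_pos (by positivity)
      rw [Real.log_div hpos.ne' hs.ne'] at h2
      have hsq : ‖x - y‖ ^ 2 = ‖x - x₁‖ ^ 2 + 2 * inner ℝ (x - x₁) (x₁ - y) + s ^ 2 := by
        rw [← hdist, ← norm_add_sq_real]; congr 2; abel
      have h3 : v x ≤ α * (‖x - y‖ - s) := by
        calc v x ≤ α * s * (Real.log ‖x - y‖ - Real.log s) := by linarith
          _ ≤ α * s * (‖x - y‖ / s - 1) := by gcongr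
          _ = α * (‖x - y‖ - s) := by field_simp
      -- The distance to the circle is linear along the normal up to a quadratic error, which the
      -- choice of neighbourhood absorbs into `ε * ‖x - x₁‖`.
      have h4 : ‖x - y‖ - s ≤ s⁻¹ * inner ℝ (x - x₁) (x₁ - y) + ‖x - x₁‖ ^ 2 / (2 * s) := by
        rw [show s⁻¹ * inner ℝ (x - x₁) (x₁ - y) + ‖x - x₁‖ ^ 2 / (2 * s) =
          (‖x - y‖ ^ 2 - s ^ 2) / (2 * s) by rw [hsq]; field_simp; ring, le_div_iff₀ (by positivity)]
        nlinarith [sq_nonneg (‖x - y‖ - s)]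
      have h5 : α * (‖x - x₁‖ ^ 2 / (2 * s)) ≤ ε * ‖x - x₁‖ := by
        rw [lt_div_iff₀ hα0] at hx2
        rw [← mul_div_assoc, div_le_iff₀ (by positivity)]
        nlinarith [norm_nonneg (x - x₁)]
      rw [inner_smul_right] at *
      have h6 := le_max_left (s⁻¹ * inner ℝ (x - x₁) (x₁ - y)) 0
      nlinarith
  have h1 := hv.fbc x₁ hx₁ y s htan α hbelow
  have h2 := Real.sqrt_lt_sqrt hlam.le hf
  linarith

/-- Where a subsolution is small at scale `s`, balls of radius `s` on which it vanishes can be moved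
around. -/
theorem IsSubsolution.disjoint_ball_of_convex {D : Set Plane} {f g v : Plane → ℝ}
    (hv : IsSubsolution D f g v) {lam : ℝ} (hlam : 0 < lam) (hf : ∀ x, lam < f x) {C : Set Plane}
    (hC : Convex ℝ C) {s : ℝ} (hs : 0 < s) (hD : ∀ y ∈ C, Disjoint (closedBall y (2 * s)) D)
    (hle : ∀ y ∈ C, ∀ x ∈ closedBall y (2 * s), v x ≤ √lam * Real.log 2 / 2 * s) {y z : Plane}
    (hy : y ∈ C) (hz : z ∈ C) (hdis : Disjoint (ball y s) (posSet D v)) :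
    Disjoint (ball z s) (posSet D v) := by
  set ℓ : ℝ → Plane := fun t => AffineMap.lineMap y z t with hℓ
  have hℓc : Continuous ℓ := AffineMap.lineMap_continuous
  have hℓC : ∀ t ∈ Set.Icc (0 : ℝ) 1, ℓ t ∈ C := fun t ht => hC.lineMap_mem hy hz ht
  -- Continuity method along the segment: `A` is closed, and it is open because a contact would
  -- force growth excluded by `hle`.
  set A : Set ℝ := {t | Disjoint (ball (ℓ t) s) (posSet D v)} with hA
  have hAc : IsClosed A := by
    have : A = ⋂ w ∈ posSet D v, {t | s ≤ dist w (ℓ t)} := by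
      ext t
      simp only [hA, Set.mem_ofPred_eq, Set.mem_iInter, Set.disjoint_left, mem_ball]
      exact ⟨fun h w hw => not_lt.1 fun h' => h h' hw, fun h w h' hw => (h w hw).not_gt h'⟩
    rw [this]
    exact isClosed_biInter fun w _ => isClosed_le continuous_const (by fun_prop)
  have hopen : ∀ t ∈ Set.Icc (0 : ℝ) 1, t ∈ A → A ∈ 𝓝 t := by
    intro t ht htA
    have hsep : Disjoint (closedBall (ℓ t) s) (closure (posSet D v)) := by
      rw [Set.disjoint_left]
      intro x₁ hx₁ hx₁'
      obtain ⟨hfr, hdist⟩ := frontier_of_disjoint_ball hs htA hx₁ hx₁'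
      obtain ⟨x, hx, hlt⟩ := hv.exists_lt_of_tangent hlam (hf x₁) hfr ⟨hs, htA, hdist⟩
        (hD _ (hℓC t ht))
      exact (hle _ (hℓC t ht) x hx).not_gt hlt
    obtain ⟨δ, hδ, hdisδ⟩ := hsep.exists_thickenings (isCompact_closedBall _ _) isClosed_closure
    have hmem : ℓ ⁻¹' ball (ℓ t) δ ∈ 𝓝 t := hℓc.continuousAt.preimage_mem_nhds (ball_mem_nhds _ hδ)
    filter_upwards [hmem] with τ hτ
    refine hdisδ.mono (fun x hx => ?_)
      (subset_closure.trans (self_subset_thickening hδ _))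
    rw [thickening_closedBall hδ hs.le, mem_ball]
    calc dist x (ℓ t) ≤ dist x (ℓ τ) + dist (ℓ τ) (ℓ t) := dist_triangle _ _ _
      _ < δ + s := by rw [add_comm]; exact add_lt_add hτ hx
  have h0 : (0 : ℝ) ∈ A := by simpa [hA, hℓ] using hdis
  have hsub : Set.Icc (0 : ℝ) 1 ⊆ A := by
    refine (hAc.inter isClosed_Icc).Icc_subset_of_forall_mem_nhdsWithin h0 fun t ht => ?_
    exact mem_nhdsWithin_of_mem_nhds (hopen t ⟨ht.2.1, ht.2.2.le⟩ ht.1)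
  have := hsub (Set.right_mem_Icc.2 zero_le_one)
  simpa [hA, hℓ] using this

/-- Near an exterior tangent ball of radius `s`, a subsolution lies below a harmonic function with
almost the same values on the concentric circle of radius `4 * s` by a logarithmic potential of
mass comparable to `s`. -/
theorem IsSubsolution.exists_harmonic_majorant {D : Set Plane} {f g v : Plane → ℝ}
    (hv : IsSubsolution D f g v) {lam : ℝ} (hlam : 0 < lam) {x₁ y : Plane} {s : ℝ}
    (hf : lam < f x₁) (hx₁ : x₁ ∈ frontier (posSet D v))
    (htan : IsExteriorTangentBall (posSet D v) x₁ y s) (hD : Disjoint (closedBall y (4 * s)) D)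
    {η : ℝ} (hη : 0 < η) :
    ∃ Φ : Plane → ℝ, HarmonicOnNhd Φ Set.univ ∧ (∀ x ∈ sphere y (4 * s), Φ x ≤ v x + η) ∧
      ∀ x ∈ closedBall y (4 * s),
        v x + √lam / 20 * s * Real.log (4 * s / max ‖x - y‖ s) ≤ Φ x := by
  obtain ⟨hs, hdis, hdist⟩ := id htan
  have hlog2 : 0 < Real.log 2 := Real.log_pos one_lt_two
  have hlog4 : Real.log 4 = 2 * Real.log 2 := by
    rw [show (4 : ℝ) = 2 ^ 2 by norm_num, Real.log_pow]; norm_num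
  have hsl : 0 < √lam := Real.sqrt_pos.2 hlam
  have hcont := hv.continuousOn_of_disjoint hD
  have hvis := hv.viscositySubharmonicOn_of_disjoint isOpen_ball
    (hD.mono_left ball_subset_closedBall)
  have hzero := hv.eq_zero_of_disjoint hs (hD.mono_left (closedBall_subset_closedBall (by linarith)))
    hdis
  obtain ⟨Ψ, hΨ, hΨv⟩ := exists_harmonic_near_on_sphere (v := v) (y := y) (R := 4 * s)
    (by linarith) (hcont.mono sphere_subset_closedBall) (half_pos hη)
  set Φ : Plane → ℝ := fun x => Ψ x + η / 2 with hΦ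
  have hΦh : HarmonicOnNhd Φ Set.univ := HarmonicOnNhd.add hΨ (harmonicOnNhd_const (η / 2))
  have hΦv : ∀ x ∈ sphere y (4 * s), v x ≤ Φ x := fun x hx => by
    have := (abs_le.1 (hΨv x hx)).1
    simp only [hΦ]; linarith
  have hle : ∀ x ∈ closedBall y (4 * s), v x ≤ Φ x :=
    hvis.le_of_le_boundary (isCompact_closedBall _ _) isOpen_ball ball_subset_closedBall hcont
      (hΦh.continuousOn.mono (Set.subset_univ _)) (fun x _ => (hΦh x trivial).1)
      (fun x _ => (hΦh x trivial).2.eq_of_nhds.le)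
      fun x hx hx' => hΦv x (le_antisymm (mem_closedBall.1 hx) (not_lt.1 hx'))
  have hΦ0 : ∀ x ∈ sphere y (4 * s), 0 ≤ Φ x := fun x hx =>
    (hv.nonneg x (hD.notMem_of_mem_left (sphere_subset_closedBall hx))).trans (hΦv x hx)
  have hharn := fun w (hw : w ∈ ball y (4 * s)) =>
    harnack (hΦh.mono (Set.subset_univ (closedBall y (4 * s)))) hΦ0 hw
  obtain ⟨x₂, hx₂, hlt⟩ := hv.exists_lt_of_tangent hlam hf hx₁ htan
    (hD.mono_left (closedBall_subset_closedBall (by linarith)))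
  -- Harnack at distance at most `2 * s` from the center, with radius `4 * s`, costs a factor `3`.
  have hΦy : √lam * Real.log 2 / 6 * s ≤ Φ y := by
    rw [mem_closedBall, dist_eq_norm] at hx₂
    have h1 := (hharn x₂ (by rw [mem_ball, dist_eq_norm]; linarith)).2
    have h2 := hle x₂ (by rw [mem_closedBall, dist_eq_norm]; linarith)
    have hΦy0 : 0 ≤ Φ y :=
      (hv.nonneg y (hD.notMem_of_mem_left (mem_closedBall_self (by linarith)))).trans
        (hle y (mem_closedBall_self (by linarith)))
    have h3 : (4 * s + ‖x₂ - y‖) / (4 * s - ‖x₂ - y‖) ≤ 3 := by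
      rw [div_le_iff₀ (by linarith)]; linarith
    have h4 := mul_le_mul_of_nonneg_right h3 hΦy0
    linarith
  -- Harnack again, with factor `3 / 5`; the result is `√lam / 20 * s * log 4`, the value of the
  -- potential on the circle of radius `s`.
  have hin : ∀ x ∈ closedBall y s, √lam * Real.log 2 / 10 * s ≤ Φ x := by
    intro x hx
    rw [mem_closedBall, dist_eq_norm] at hx
    have h1 := (hharn x (by rw [mem_ball, dist_eq_norm]; linarith)).1
    have h3 : 3 / 5 ≤ (4 * s - ‖x - y‖) / (4 * s + ‖x - y‖) := by
      rw [le_div_iff₀ (by positivity)]; linarith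
    have h4 : 3 / 5 * (√lam * Real.log 2 / 6 * s) ≤
        (4 * s - ‖x - y‖) / (4 * s + ‖x - y‖) * Φ y := by gcongr
    linarith
  set a : ℝ := √lam / 20 * s with ha
  have hann : ∀ x, s ≤ ‖x - y‖ → ‖x - y‖ ≤ 4 * s →
      v x ≤ (Φ x + -(a * Real.log (4 * s))) + a * Real.log ‖x - y‖ := by
    refine hvis.le_add_log_of_annulus hs hcont
      (HarmonicOnNhd.add hΦh (harmonicOnNhd_const (-(a * Real.log (4 * s))))) (fun x hx => ?_)
      fun x hx => ?_
    · have hmem : x ∈ closedBall y s := by rw [mem_closedBall, dist_eq_norm, hx]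
      have := hin x hmem
      rw [hzero x hmem, hx, Real.log_mul (by norm_num) hs.ne', hlog4]
      rw [ha]; linarith
    · have := hΦv x (by rw [mem_sphere, dist_eq_norm, hx])
      rw [hx]
      linarith
  refine ⟨Φ, hΦh, fun x hx => ?_, fun x hx => ?_⟩
  · have := (abs_le.1 (hΨv x hx)).2
    simp only [hΦ]; linarith
  · rw [mem_closedBall, dist_eq_norm] at hx
    rcases le_total ‖x - y‖ s with h | h
    · have hmem : x ∈ closedBall y s := by rwa [mem_closedBall, dist_eq_norm]
      have := hin x hmem
      rw [hzero x hmem, max_eq_right h, mul_div_assoc, div_self hs.ne', mul_one, hlog4, ha]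
      linarith
    · have h1 := hann x h hx
      rw [max_eq_left h, Real.log_div (by positivity) (by linarith)]
      linarith

/-! ### Superposition of logarithmic potentials -/

theorem harmonicAt_finset_sum {ι : Type*} {F : ι → Plane → ℝ} {x : Plane} (J : Finset ι)
    (h : ∀ i ∈ J, HarmonicAt (F i) x) : HarmonicAt (fun z => ∑ i ∈ J, F i z) x := by
  classical
  induction J using Finset.induction_on with
  | empty => simp
  | insert i J hi ih =>
    simp only [Finset.sum_insert hi]
    exact HarmonicAt.add (h i (Finset.mem_insert_self i J))
      (ih fun j hj => h j (Finset.mem_insert_of_mem hj))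

/-- The logarithmic potential of a mass spread over the circle of radius `s` about `y`, normalized
to vanish at distance `ρ'` from `y`. -/
def cappedLog (ρ' s : ℝ) (y x : Plane) : ℝ := Real.log (ρ' / max ‖x - y‖ s)

theorem continuous_cappedLog {ρ' s : ℝ} (hρ' : 0 < ρ') (hs : 0 < s) (y : Plane) :
    Continuous (cappedLog ρ' s y) := by
  have hpos : ∀ x : Plane, 0 < max ‖x - y‖ s := fun x => lt_max_of_lt_right hs
  unfold cappedLog
  refine Continuous.log ?_ fun x => (div_pos hρ' (hpos x)).ne'
  exact continuous_const.div (by fun_prop) fun x => (hpos x).ne'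

theorem harmonicAt_mul_cappedLog {ρ' s : ℝ} (hρ' : 0 < ρ') (hs : 0 < s) {x y : Plane}
    (h : s < ‖x - y‖) (a : ℝ) : HarmonicAt (fun z => a * cappedLog ρ' s y z) x := by
  have hne : x ≠ y := by
    rintro rfl
    simp at h
    linarith
  have h1 : HarmonicAt (fun z : Plane => a * Real.log ρ' + (-a) * Real.log ‖z - y‖) x :=
    HarmonicAt.add (harmonicAt_const _) (harmonicAt_const_mul_log hne (-a))
  refine (harmonicAt_congr_nhds ?_).1 h1
  have hc : ContinuousAt (fun z : Plane => ‖z - y‖) x := by fun_prop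
  filter_upwards [hc.eventually (lt_mem_nhds h)] with z hz
  rw [cappedLog, max_eq_left hz.le, Real.log_div hρ'.ne' (by linarith)]
  ring

/-- Superposition of the potentials of disjoint exterior tangent balls. -/
theorem add_sum_cappedLog_le {ι : Type*} (J : Finset ι) {y : ι → Plane} {s : ι → ℝ}
    {v : Plane → ℝ} {x₀ : Plane} {ρ ρ' M c : ℝ} (hρ : 0 < ρ) (hρ' : 0 < ρ') (hc : 0 ≤ c)
    (hv : ContinuousOn v (closedBall x₀ ρ)) (hvis : ViscositySubharmonicOn v (ball x₀ ρ))
    (hM : ∀ x ∈ closedBall x₀ ρ, v x ≤ M) (hs : ∀ i ∈ J, 0 < s i)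
    (hsub : ∀ i ∈ J, closedBall (y i) (4 * s i) ⊆ ball x₀ ρ)
    (hdisj : ∀ i ∈ J, ∀ j ∈ J, i ≠ j →
      Disjoint (closedBall (y i) (4 * s i)) (closedBall (y j) (4 * s j)))
    (hfar : ∀ i ∈ J, ∀ x ∈ sphere x₀ ρ, ρ' ≤ ‖x - y i‖)
    (hmaj : ∀ i ∈ J, ∀ η > 0, ∃ Φ : Plane → ℝ, HarmonicOnNhd Φ Set.univ ∧
      (∀ x ∈ sphere (y i) (4 * s i), Φ x ≤ v x + η) ∧
      ∀ x ∈ closedBall (y i) (4 * s i),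
        v x + c * s i * Real.log (4 * s i / max ‖x - y i‖ (s i)) ≤ Φ x) :
    ∀ x ∈ closedBall x₀ ρ, v x + ∑ i ∈ J, c * s i * cappedLog ρ' (s i) (y i) x ≤ M := by
  classical
  set B : ι → Plane → ℝ := fun i x => c * s i * cappedLog ρ' (s i) (y i) x with hB
  have hBc : ∀ i ∈ J, Continuous (B i) := fun i hi =>
    continuous_const.mul (continuous_cappedLog hρ' (hs i hi) (y i))
  have hBh : ∀ i ∈ J, ∀ x, s i < ‖x - y i‖ → HarmonicAt (B i) x := fun i hi x hx =>
    harmonicAt_mul_cappedLog hρ' (hs i hi) hx _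
  have hBbd : ∀ i ∈ J, ∀ x ∈ sphere x₀ ρ, B i x ≤ 0 := by
    intro i hi x hx
    have h1 : ρ' / max ‖x - y i‖ (s i) ≤ 1 :=
      div_le_one_of_le₀ ((hfar i hi x hx).trans (le_max_left _ _))
        ((hs i hi).le.trans (le_max_right _ _))
    have h0 : 0 ≤ ρ' / max ‖x - y i‖ (s i) :=
      div_nonneg hρ'.le ((hs i hi).le.trans (le_max_right _ _))
    exact mul_nonpos_of_nonneg_of_nonpos (mul_nonneg hc (hs i hi).le) (Real.log_nonpos h0 h1)
  have hSc : Continuous fun x => ∑ i ∈ J, B i x := continuous_finsetSum _ hBc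
  have key : ∀ ε > 0, ∀ x ∈ closedBall x₀ ρ, v x + ∑ i ∈ J, B i x ≤ M + ε * ρ ^ 2 := by
    intro ε hε
    obtain ⟨z, hz, hzmax⟩ := (isCompact_closedBall x₀ ρ).exists_isMaxOn
      ⟨x₀, mem_closedBall_self hρ.le⟩
      (f := fun x => v x - (-(∑ i ∈ J, B i x) - ε * ‖x - x₀‖ ^ 2))
      (hv.sub (by fun_prop))
    suffices h : v z - (-(∑ i ∈ J, B i z) - ε * ‖z - x₀‖ ^ 2) ≤ M + ε * ρ ^ 2 by
      intro x hx
      have h1 := hzmax hx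
      simp only [Set.mem_ofPred_eq] at h1
      have : 0 ≤ ε * ‖x - x₀‖ ^ 2 := by positivity
      linarith
    by_contra! hbig
    have hzb : z ∈ ball x₀ ρ := by
      refine lt_of_le_of_ne (mem_closedBall.1 hz) fun h => ?_
      have h1 := Finset.sum_nonpos fun i hi => hBbd i hi z h
      have h2 := hM z hz
      rw [dist_eq_norm] at h
      rw [h] at hbig
      linarith
    by_cases hhole : ∀ i ∈ J, s i < ‖z - y i‖
    · have hh : HarmonicAt (fun x => -(∑ i ∈ J, B i x)) z :=
        (harmonicAt_finset_sum J fun i hi => hBh i hi z (hhole i hi)).neg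
      have h1 := hvis z hzb _ (contDiffAt_sub_mul_norm_sub_sq hh.1 ε x₀)
        (hzmax.isLocalMax (mem_of_superset (isOpen_ball.mem_nhds hzb) ball_subset_closedBall))
      rw [laplacian_sub_mul_norm_sub_sq hh.1, hh.2.eq_of_nhds] at h1
      simp only [Pi.zero_apply] at h1
      linarith
    · push Not at hhole
      obtain ⟨i, hi, hzi⟩ := hhole
      have hsi := hs i hi
      -- If the maximum lies in the `i`-th small ball, where `B i` is not known to be harmonic, the
      -- majorant replaces `v` plus the `i`-th potential, and the other potentials are harmonic
      -- there since the balls are disjoint.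
      obtain ⟨Φ, hΦ, hΦ1, hΦ2⟩ := hmaj i hi (ε * s i ^ 2) (by positivity)
      set ψ : Plane → ℝ := fun x => (Φ x + c * s i * Real.log (ρ' / (4 * s i))) +
        ∑ j ∈ J.erase i, B j x with hψ
      have hψh : HarmonicOnNhd ψ (closedBall (y i) (4 * s i)) := by
        intro x hx
        refine HarmonicAt.add (HarmonicAt.add (hΦ x trivial) (harmonicAt_const _))
          (harmonicAt_finset_sum _ fun j hj => ?_)
        have hj' := Finset.mem_erase.1 hj
        refine hBh j hj'.2 x (not_le.1 fun h => ?_)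
        refine (hdisj i hi j hj'.2 hj'.1.symm).notMem_of_mem_left hx ?_
        rw [mem_closedBall, dist_eq_norm]
        linarith [hs j hj'.2]
      have hBi : ∀ x, B i x = c * s i * Real.log (4 * s i / max ‖x - y i‖ (s i)) +
          c * s i * Real.log (ρ' / (4 * s i)) := by
        intro x
        have hpos : 0 < max ‖x - y i‖ (s i) := lt_max_of_lt_right hsi
        simp only [hB, cappedLog]
        rw [Real.log_div hρ'.ne' hpos.ne', Real.log_div (by positivity) hpos.ne',
          Real.log_div hρ'.ne' (by positivity)]
        ring
      have hsum : ∀ x, ∑ j ∈ J, B j x = B i x + ∑ j ∈ J.erase i, B j x := fun x =>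
        (Finset.add_sum_erase J (fun j => B j x) hi).symm
      have h2c : ∀ x ∈ closedBall (y i) (4 * s i),
          ContDiffAt ℝ 2 (fun z => ψ z - (-ε) * ‖z - x₀‖ ^ 2) x := fun x hx =>
        contDiffAt_sub_mul_norm_sub_sq (hψh x hx).1 (-ε) x₀
      have h3c : ∀ x ∈ closedBall (y i) (4 * s i),
          ContDiffAt ℝ 2 (fun z => (ψ z - (-ε) * ‖z - x₀‖ ^ 2) - ε * ‖z - y i‖ ^ 2) x :=
        fun x hx => contDiffAt_sub_mul_norm_sub_sq (h2c x hx) ε (y i)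
      -- Subtracting `ε * ‖z - y i‖ ^ 2` makes the sum harmonic. It loses `16 * ε * s i ^ 2` on the
      -- circle but at most `ε * s i ^ 2` at `z`, which beats the approximation error `ε * s i ^ 2`.
      have hmax := le_of_le_sphere
        (Φ := fun z => (ψ z - (-ε) * ‖z - x₀‖ ^ 2) - ε * ‖z - y i‖ ^ 2) (c := y i) (R := 4 * s i)
        (a := v z - (-(∑ i ∈ J, B i z) - ε * ‖z - x₀‖ ^ 2) + ε * s i ^ 2 - ε * (4 * s i) ^ 2)
        (fun x hx => (h3c x hx).continuousAt.continuousWithinAt)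
        (viscositySubharmonicOn_of_laplacian_nonneg
          (fun x hx => h3c x (ball_subset_closedBall hx)) fun x hx => by
            have hx' := ball_subset_closedBall hx
            rw [laplacian_sub_mul_norm_sub_sq (h2c x hx'),
              laplacian_sub_mul_norm_sub_sq (hψh x hx').1, (hψh x hx').2.eq_of_nhds]
            simp)
        (fun x hx => by
          have h1 := hzmax (ball_subset_closedBall (hsub i hi (sphere_subset_closedBall hx)))
          have h2 := hΦ1 x hx
          simp only [Set.mem_ofPred_eq] at h1
          rw [mem_sphere, dist_eq_norm] at hx
          rw [hsum x, hBi x, hx, max_eq_left (by linarith), div_self (by positivity),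
            Real.log_one] at h1
          simp only [hψ, hx]
          linarith)
        z (by rw [mem_closedBall, dist_eq_norm]; linarith)
      have h4 := hΦ2 z (by rw [mem_closedBall, dist_eq_norm]; linarith)
      simp only [hψ] at hmax
      rw [hsum z, hBi z] at hmax
      have h5 : ε * ‖z - y i‖ ^ 2 ≤ ε * s i ^ 2 := by gcongr
      have h6 : 0 < ε * s i ^ 2 := by positivity
      nlinarith
  intro x hx
  refine le_of_forall_pos_le_add fun δ hδ => ?_
  have := key (δ / ρ ^ 2) (by positivity) x hx
  rwa [div_mul_cancel₀ _ (by positivity)] at this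

/-! ### Harmonic replacement -/

/-- Replacing a subsolution by the harmonic function with the same values on a circle contained in
`closure Ω(v)` gives a subsolution. -/
theorem IsSubsolution.exists_harmonic_replacement {D : Set Plane} {f g v : Plane → ℝ}
    (hv : IsSubsolution D f g v) (hDo : IsOpen D) {x₀ : Plane} {t : ℝ}
    (hD : Disjoint (closedBall x₀ t) D) (hsph : sphere x₀ t ⊆ closure (posSet D v)) {z : Plane}
    (hz : z ∈ ball x₀ t) (hvz : 0 < v z) :
    ∃ w : Plane → ℝ, IsSubsolution D f g w ∧ (∀ x ∉ ball x₀ t, w x = v x) ∧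
      (∀ x ∈ ball x₀ t, 0 < w x) ∧
      ∀ φ : Plane → ℝ, ContinuousOn φ (closedBall x₀ t) → HarmonicOnNhd φ (ball x₀ t) →
        (∀ x ∈ sphere x₀ t, v x ≤ φ x) → ∀ x ∈ closedBall x₀ t, w x ≤ φ x := by
  classical
  have ht : 0 < t := pos_of_mem_ball hz
  have hcont := hv.continuousOn_of_disjoint hD
  have hvis := hv.viscositySubharmonicOn_of_disjoint isOpen_ball
    (hD.mono_left ball_subset_closedBall)
  have hv0 : ∀ x ∈ closedBall x₀ t, 0 ≤ v x := fun x hx => hv.nonneg x (hD.notMem_of_mem_left hx)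
  obtain ⟨H, Φ, hHc, hHv, hΦ, hlim⟩ := exists_dirichlet ht (hcont.mono sphere_subset_closedBall)
  have hΦc : ∀ n s, ContinuousOn (Φ n) s := fun n s => (hΦ n).continuousOn.mono (Set.subset_univ _)
  have hHvis : ViscositySubharmonicOn H (ball x₀ t) :=
    viscositySubharmonicOn_of_tendstoUniformlyOn isOpen_ball (fun n => hΦc n _)
      (fun n => viscositySubharmonicOn_of_harmonicOnNhd ((hΦ n).mono (Set.subset_univ _)))
      (hlim.mono ball_subset_closedBall)
  have happrox : ∀ ε > 0, ∃ n, ∀ x ∈ closedBall x₀ t, |H x - Φ n x| < ε := fun ε hε =>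
    (Metric.tendstoUniformlyOn_iff.1 hlim ε hε).exists
  have hvH : ∀ x ∈ closedBall x₀ t, v x ≤ H x := by
    intro x hx
    refine le_of_forall_pos_le_add fun ε hε => ?_
    obtain ⟨n, hn⟩ := happrox (ε / 2) (half_pos hε)
    have hh : HarmonicOnNhd (fun x => Φ n x + ε / 2) Set.univ :=
      HarmonicOnNhd.add (hΦ n) (harmonicOnNhd_const (ε / 2))
    have := hvis.le_of_le_boundary (φ := fun x => Φ n x + ε / 2) (isCompact_closedBall _ _)
      isOpen_ball ball_subset_closedBall hcont (hh.continuousOn.mono (Set.subset_univ _))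
      (fun x _ => (hh x trivial).1) (fun x _ => (hh x trivial).2.eq_of_nhds.le)
      (fun y hy hy' => by
        have h1 := hHv y (le_antisymm (mem_closedBall.1 hy) (not_lt.1 hy'))
        have h2 := abs_lt.1 (hn y hy)
        linarith [h2.2]) x hx
    have h2 := abs_lt.1 (hn x hx)
    linarith [h2.1]
  -- Harnack from `z` to the center and from the center to `x`, applied to nonnegative harmonic
  -- approximants, carries positivity from `z` to the whole disc.
  have hHpos : ∀ x ∈ ball x₀ t, 0 < H x := by
    intro x hx
    have hHz : 0 < H z := hvz.trans_le (hvH z (ball_subset_closedBall hz))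
    have hxt : ‖x - x₀‖ < t := by simpa [dist_eq_norm] using hx
    have hzt : ‖z - x₀‖ < t := by simpa [dist_eq_norm] using hz
    set p : ℝ := (t - ‖x - x₀‖) / (t + ‖x - x₀‖) with hp
    set q : ℝ := (t + ‖z - x₀‖) / (t - ‖z - x₀‖) with hq
    have hp0 : 0 < p := div_pos (by linarith) (by positivity)
    have hq0 : 0 < q := div_pos (by positivity) (by linarith)
    suffices h : p * H z ≤ q * H x by
      have : 0 < q * H x := (mul_pos hp0 hHz).trans_le h
      exact (mul_pos_iff_of_pos_left hq0).1 this
    refine le_of_forall_pos_le_add fun δ hδ => ?_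
    obtain ⟨n, hn⟩ := happrox (δ / (2 * q)) (by positivity)
    have hh : HarmonicOnNhd (fun x => Φ n x + δ / (2 * q)) (closedBall x₀ t) :=
      HarmonicOnNhd.add ((hΦ n).mono (Set.subset_univ _)) (harmonicOnNhd_const (δ / (2 * q)))
    have hharn := fun w (hw : w ∈ ball x₀ t) => harnack hh (fun y hy => by
      have hy' := sphere_subset_closedBall hy
      linarith [(abs_lt.1 (hn y hy')).2, hvH y hy', hv0 y hy']) hw
    have h1 := (hharn x hx).1
    have h2 := (hharn z hz).2
    have h3 := (abs_lt.1 (hn z (ball_subset_closedBall hz))).2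
    have h4 := (abs_lt.1 (hn x (ball_subset_closedBall hx))).1
    have h5 : q * (δ / (2 * q)) = δ / 2 := by field_simp
    calc p * H z ≤ p * (q * (Φ n x₀ + δ / (2 * q))) := by gcongr; linarith
      _ = q * (p * (Φ n x₀ + δ / (2 * q))) := by ring
      _ ≤ q * (Φ n x + δ / (2 * q)) := by gcongr
      _ ≤ q * (H x + δ / (2 * q) + δ / (2 * q)) := by gcongr; linarith
      _ = q * H x + δ := by rw [mul_add, mul_add, h5]; ring
  set w : Plane → ℝ := fun x => if x ∈ ball x₀ t then H x else v x with hw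
  have hwin : ∀ x ∈ ball x₀ t, w x = H x := fun x hx => if_pos hx
  have hwout : ∀ x ∉ ball x₀ t, w x = v x := fun x hx => if_neg hx
  have hwH : ∀ x ∈ closedBall x₀ t, w x = H x := fun x hx => by
    by_cases hx' : x ∈ ball x₀ t
    · exact hwin x hx'
    · rw [hwout x hx', hHv x (le_antisymm (mem_closedBall.1 hx) (not_lt.1 hx'))]
  have hvw : ∀ x, v x ≤ w x := fun x => by
    by_cases hx' : x ∈ ball x₀ t
    · rw [hwin x hx']; exact hvH x (ball_subset_closedBall hx')
    · exact (hwout x hx').ge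
  have hΩ : posSet D v ⊆ posSet D w := fun x hx => ⟨hx.1, hx.2.trans_le (hvw x)⟩
  have hballΩ : ball x₀ t ⊆ posSet D w := fun x hx =>
    ⟨hD.notMem_of_mem_left (ball_subset_closedBall hx), by rw [hwin x hx]; exact hHpos x hx⟩
  have hballD : Disjoint (ball x₀ t) (closure D) :=
    (hD.mono_left ball_subset_closedBall).closure_right isOpen_ball
  refine ⟨w, ⟨?_, fun x hx => (hv.nonneg x hx).trans (hvw x), ?_, fun x hx => ?_, ?_⟩, hwout,
    fun x hx => (hballΩ hx).2, fun φ hφc hφh hφ x hx => ?_⟩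
  · have h1 : ContinuousOn w (closedBall x₀ t) := hHc.congr hwH
    have h2 : ContinuousOn w (Dᶜ ∩ (ball x₀ t)ᶜ) :=
      (hv.continuousOn.mono Set.inter_subset_left).congr fun x hx => hwout x hx.2
    refine (h1.union_of_isClosed h2 isClosed_closedBall
      (hDo.isClosed_compl.inter isOpen_ball.isClosed_compl)).mono fun x hx => ?_
    by_cases hx' : x ∈ ball x₀ t
    · exact Or.inl (ball_subset_closedBall hx')
    · exact Or.inr ⟨hx, hx'⟩
  · intro x hx φ hφ hmax
    by_cases hx' : x ∈ ball x₀ t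
    · refine hHvis x hx' φ hφ ?_
      filter_upwards [hmax, isOpen_ball.mem_nhds hx'] with y hy hyb
      rwa [hwin y hyb, hwin x hx'] at hy
    · have hwx := hwout x hx'
      refine hv.subharmonic x ⟨⟨hx.1.1, hwx ▸ hx.1.2⟩, hx.2⟩ φ hφ ?_
      filter_upwards [hmax] with y hy
      rw [hwx] at hy
      linarith [hvw y]
  · rw [hwout x fun h => hballD.notMem_of_mem_left h (frontier_subset_closure hx)]
    exact hv.le_boundary x hx
  -- A free boundary point of `w` is outside the open disc, and by `hsph` it is in `closure Ω(v)`
  -- even on the circle. Since `v ≤ w`, tangent balls and upper bounds for `w` also serve for `v`.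
  · intro x₁ hx₁ y s htan α hα
    have hx₁b : x₁ ∉ ball x₀ t := fun h =>
      hx₁.2 (interior_maximal hballΩ isOpen_ball h)
    have hcl : x₁ ∈ closure (posSet D v) := by
      by_cases hx₁s : x₁ ∈ sphere x₀ t
      · exact hsph hx₁s
      · have hx₁c : x₁ ∈ (closedBall x₀ t)ᶜ := fun h =>
          hx₁s (le_antisymm (mem_closedBall.1 h) (not_lt.1 hx₁b))
        rw [_root_.mem_closure_iff]
        intro O hO hxO
        obtain ⟨x, hxO', hxΩ⟩ := _root_.mem_closure_iff.1 hx₁.1 _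
          (hO.inter isClosed_closedBall.isOpen_compl) ⟨hxO, hx₁c⟩
        refine ⟨x, hxO'.1, hxΩ.1, ?_⟩
        rw [← hwout x fun h => hxO'.2 (ball_subset_closedBall h)]
        exact hxΩ.2
    refine hv.fbc x₁ ⟨hcl, fun h => hx₁.2 (interior_mono hΩ h)⟩ y s
      ⟨htan.1, htan.2.1.mono_right hΩ, htan.2.2⟩ α fun ε hε => ?_
    filter_upwards [hα ε hε] with x hx using (hvw x).trans hx
  · rw [hwH x hx]
    exact hHvis.le_of_le_boundary (isCompact_closedBall _ _) isOpen_ball ball_subset_closedBall hHc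
      hφc (fun x hx => (hφh x hx).1) (fun x hx => (hφh x hx).2.eq_of_nhds.le)
      (fun y hy hy' => by
        have hys : y ∈ sphere x₀ t := le_antisymm (mem_closedBall.1 hy) (not_lt.1 hy')
        rw [hHv y hys]; exact hφ y hys) x hx

/-! ### A circle contained in the closure of the positivity set -/

/-- A Vitali covering of an interval by finitely many disjoint intervals. -/
theorem exists_finset_disjoint_of_radii {a b S : ℝ} (hab : a < b) {s : ℝ → ℝ}
    (hs : ∀ t ∈ Set.Icc a b, 0 < s t) (hS : ∀ t ∈ Set.Icc a b, s t ≤ S) :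
    ∃ J : Finset ℝ, (∀ t ∈ J, t ∈ Set.Icc a b) ∧
      (∀ i ∈ J, ∀ j ∈ J, i ≠ j → Disjoint (closedBall i (4 * s i)) (closedBall j (4 * s j))) ∧
      (b - a) / 2 < 40 * ∑ t ∈ J, s t := by
  obtain ⟨u, hu, hdisj, hcov⟩ := Vitali.exists_disjoint_subfamily_covering_enlargement_closedBall
    (Set.Icc a b) (fun t : ℝ => t) (fun t => 4 * s t) (4 * S)
    (fun t ht => by linarith [hS t ht]) 5 (by norm_num)
  have hcount : u.Countable := by
    refine hdisj.countable_of_nonempty_interior fun t ht => ?_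
    have h4 : 0 < 4 * s t := by linarith [hs t (hu ht)]
    rw [interior_closedBall _ h4.ne']
    exact ⟨t, mem_ball_self h4⟩
  by_contra! hcon
  -- The enlarged intervals have length `2 * 5 * 4 * s t = 40 * s t`. Settling for half of `b - a`
  -- allows finitely many of them.
  have hcover : Set.Icc a b ⊆ ⋃ t ∈ u, closedBall t (5 * (4 * s t)) := fun t ht => by
    obtain ⟨t', ht', hsub⟩ := hcov t ht
    exact Set.mem_biUnion ht' (hsub (mem_closedBall_self (by linarith [hs t ht])))
  have h1 : ENNReal.ofReal (b - a) ≤ ENNReal.ofReal ((b - a) / 2) := by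
    calc ENNReal.ofReal (b - a) = MeasureTheory.volume (Set.Icc a b) := Real.volume_Icc.symm
      _ ≤ MeasureTheory.volume (⋃ t ∈ u, closedBall t (5 * (4 * s t))) :=
        MeasureTheory.measure_mono hcover
      _ ≤ ∑' t : u, MeasureTheory.volume (closedBall (t : ℝ) (5 * (4 * s t))) :=
        MeasureTheory.measure_biUnion_le _ hcount _
      _ = ∑' t : u, ENNReal.ofReal (40 * s t) := by
        refine tsum_congr fun t => ?_
        rw [Real.volume_closedBall]; congr 1; ring
      _ ≤ ENNReal.ofReal ((b - a) / 2) := by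
        rw [ENNReal.tsum_eq_iSup_sum]
        refine iSup_le fun J => ?_
        rw [← ENNReal.ofReal_sum_of_nonneg fun t _ => by linarith [hs t (hu t.2)]]
        refine ENNReal.ofReal_le_ofReal ?_
        have := hcon (J.map (Function.Embedding.subtype _))
          (fun t ht => by
            obtain ⟨t', -, rfl⟩ := Finset.mem_map.1 ht
            exact hu t'.2)
          (fun i hi j hj hij => by
            obtain ⟨i', -, rfl⟩ := Finset.mem_map.1 hi
            obtain ⟨j', -, rfl⟩ := Finset.mem_map.1 hj
            exact hdisj i'.2 j'.2 hij)
        rw [Finset.sum_map, Finset.mul_sum] at this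
        exact this
  rw [ENNReal.ofReal_le_ofReal_iff (by linarith)] at h1
  linarith

/-- A point off `closure Ω(v)` is the center of an exterior tangent ball. -/
theorem exists_isExteriorTangentBall {W : Set Plane} (hW : W.Nonempty) {y : Plane}
    (hy : y ∉ closure W) :
    ∃ s x, x ∈ frontier W ∧ IsExteriorTangentBall W x y s := by
  obtain ⟨x, hx, hxd⟩ := isClosed_closure.exists_infDist_eq_dist hW.closure y
  have hpos : 0 < dist x y := dist_pos.2 fun h => hy (h ▸ hx)
  have hdis : Disjoint (ball y (dist x y)) W := Set.disjoint_left.2 fun z hz hzW => by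
    have := infDist_le_dist_of_mem (x := y) (subset_closure hzW)
    rw [hxd, dist_comm y x, dist_comm y z] at this
    exact this.not_gt hz
  exact ⟨dist x y, x, (frontier_of_disjoint_ball hpos hdis (mem_closedBall.2 le_rfl) hx).1,
    hpos, hdis, rfl⟩

/-- A subsolution that is small at scale `r` and does not vanish near the center has a full circle
in `closure Ω(v)`. -/
theorem IsSubsolution.exists_sphere_subset_closure {D : Set Plane} {f g v : Plane → ℝ}
    (hv : IsSubsolution D f g v) {lam : ℝ} (hlam : 0 < lam) (hf : ∀ x, lam < f x) {x₀ : Plane}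
    {r : ℝ} (hr : 0 < r) (hD : Disjoint (ball x₀ r) D)
    (hle : ∀ x ∈ ball x₀ r, v x ≤ √lam * Real.log 2 / 12800 * r)
    (hfat : ∀ y ∈ closedBall x₀ (r / 2), ¬ Disjoint (ball y (r / 16)) (posSet D v)) :
    ∃ t ∈ Set.Icc (r / 8) (r / 4), sphere x₀ t ⊆ closure (posSet D v) := by
  by_contra! hcon
  have hlog2 : 0 < Real.log 2 := Real.log_pos one_lt_two
  have hsl : 0 < √lam := Real.sqrt_pos.2 hlam
  have hne : (posSet D v).Nonempty := by
    obtain ⟨z, -, hz⟩ := Set.not_disjoint_iff.1 (hfat x₀ (mem_closedBall_self (by positivity)))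
    exact ⟨z, hz⟩
  have hex : ∀ t, ∃ (y : Plane) (s : ℝ) (x : Plane), t ∈ Set.Icc (r / 8) (r / 4) →
      y ∈ sphere x₀ t ∧ x ∈ frontier (posSet D v) ∧ IsExteriorTangentBall (posSet D v) x y s := by
    intro t
    by_cases ht : t ∈ Set.Icc (r / 8) (r / 4)
    · obtain ⟨y, hy, hy'⟩ := Set.not_subset.1 (hcon t ht)
      obtain ⟨s, x, hx, htan⟩ := exists_isExteriorTangentBall hne hy'
      exact ⟨y, s, x, fun _ => ⟨hy, hx, htan⟩⟩
    · exact ⟨x₀, 0, x₀, fun h => absurd h ht⟩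
  choose y s x₁ hys using hex
  have hs0 : ∀ t ∈ Set.Icc (r / 8) (r / 4), 0 < s t := fun t ht => (hys t ht).2.2.1
  have hsr : ∀ t ∈ Set.Icc (r / 8) (r / 4), s t ≤ r / 16 := by
    intro t ht
    by_contra! h
    obtain ⟨hy, -, -, hdis, -⟩ := hys t ht
    refine hfat (y t) ?_ (hdis.mono_left (ball_subset_ball h.le))
    rw [mem_sphere] at hy
    rw [mem_closedBall, hy]
    linarith [ht.2]
  obtain ⟨J, hJ, hJdisj, hJsum⟩ := exists_finset_disjoint_of_radii (a := r / 8) (b := r / 4)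
    (by linarith) hs0 hsr
  have hsubball : ∀ t ∈ J, closedBall (y t) (4 * s t) ⊆ ball x₀ (3 * r / 4) := by
    intro t ht x hx
    have h1 := (hys t (hJ t ht)).1
    rw [mem_sphere] at h1
    rw [mem_closedBall] at hx
    rw [mem_ball]
    linarith [dist_triangle x (y t) x₀, (hJ t ht).2, hsr t (hJ t ht)]
  have hbig : closedBall x₀ (3 * r / 4) ⊆ ball x₀ r := closedBall_subset_ball (by linarith)
  have hpot := add_sum_cappedLog_le J (y := y) (s := s) (v := v) (x₀ := x₀) (ρ := 3 * r / 4)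
    (ρ' := r / 2) (M := √lam * Real.log 2 / 12800 * r) (c := √lam / 20) (by positivity)
    (by positivity) (by positivity) (hv.continuousOn_of_disjoint (hD.mono_left hbig))
    (hv.viscositySubharmonicOn_of_disjoint isOpen_ball
      (hD.mono_left (ball_subset_closedBall.trans hbig)))
    (fun x hx => hle x (hbig hx)) (fun t ht => hs0 t (hJ t ht)) hsubball
    (fun i hi j hj hij => by
      rw [Set.disjoint_left]
      intro x hxi hxj
      -- The distance to `x₀` is 1-Lipschitz and maps each ball into its interval of radii, so
      -- disjoint intervals give disjoint balls.
      refine Set.disjoint_iff.1 (hJdisj i hi j hj hij) (show dist x x₀ ∈ _ ∩ _ from ⟨?_, ?_⟩)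
      · have h1 := (hys i (hJ i hi)).1
        rw [mem_sphere] at h1
        rw [mem_closedBall] at hxi ⊢
        have h2 := dist_dist_dist_le_left x (y i) x₀
        rw [h1] at h2
        exact h2.trans hxi
      · have h1 := (hys j (hJ j hj)).1
        rw [mem_sphere] at h1
        rw [mem_closedBall] at hxj ⊢
        have h2 := dist_dist_dist_le_left x (y j) x₀
        rw [h1] at h2
        exact h2.trans hxj)
    (fun t ht x hx => by
      have h1 := (hys t (hJ t ht)).1
      rw [mem_sphere] at h1 hx
      rw [← dist_eq_norm]
      linarith [dist_triangle x (y t) x₀, (hJ t ht).2])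
    (fun t ht η hη => hv.exists_harmonic_majorant hlam (hf _) (hys t (hJ t ht)).2.1
      (hys t (hJ t ht)).2.2
      (hD.mono_left ((hsubball t ht).trans (ball_subset_ball (by linarith)))) hη)
    x₀ (mem_closedBall_self (by positivity))
  have hterm : ∀ t ∈ J, √lam / 20 * Real.log 2 * s t ≤
      √lam / 20 * s t * cappedLog (r / 2) (s t) (y t) x₀ := by
    intro t ht
    have h1 := (hys t (hJ t ht)).1
    rw [mem_sphere, dist_comm, dist_eq_norm] at h1
    have h2 := hJ t ht
    have h3 := hsr t h2
    have h4 := hs0 t h2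
    -- The center `y t` is at distance `t` from `x₀`, with `s t ≤ r / 16 < t ≤ r / 4`, so the ratio
    -- inside the logarithm is at least `2`.
    have h5 : Real.log 2 ≤ cappedLog (r / 2) (s t) (y t) x₀ := by
      rw [cappedLog, h1, max_eq_left (by linarith [h2.1])]
      refine Real.log_le_log two_pos ?_
      rw [le_div_iff₀ (by linarith [h2.1])]
      linarith [h2.2]
    calc √lam / 20 * Real.log 2 * s t = √lam / 20 * s t * Real.log 2 := by ring
      _ ≤ _ := by gcongr
  have hsum := Finset.sum_le_sum hterm
  rw [← Finset.mul_sum] at hsum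
  have hv0 : 0 ≤ v x₀ := hv.nonneg x₀ (hD.notMem_of_mem_left (mem_ball_self hr))
  -- The radii fill an interval of length `r / 8`, so `∑ s t > r / 640`; then `20 * 640 = 12800`.
  have hlow : √lam / 20 * Real.log 2 * (r / 640) < √lam / 20 * Real.log 2 * ∑ t ∈ J, s t := by
    gcongr
    linarith
  linarith

/-! ### The logarithmic barrier -/

section Barrier

variable {lam ρ m : ℝ} {p : Plane}

theorem barrierRadius_nonneg (hρ : 0 < ρ) : 0 ≤ barrierRadius lam ρ m :=
  Real.sInf_nonneg fun _ hR => hρ.le.trans hR.1.le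

/-- This sign, with `barrierRadius_nonneg`, is all that is needed about `R₀`. Default values (`sInf
∅ = 0`, division by zero, `log 0 = 0`) cover the degenerate cases, so `R₀ > ρ` need not be proved.
-/
theorem barrier_coeff_nonpos (hρ : 0 < ρ) (hm : 0 < m) :
    m / Real.log (ρ / barrierRadius lam ρ m) ≤ 0 := by
  refine div_nonpos_of_nonneg_of_nonpos hm.le (Real.log_nonpos
    (div_nonneg hρ.le (barrierRadius_nonneg hρ)) ?_)
  rcases Set.eq_empty_or_nonempty {R : ℝ | ρ < R ∧ m ^ 2 / (R ^ 2 * Real.log (ρ / R) ^ 2) < lam}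
    with h | h
  · simp [barrierRadius, h]
  · have : ρ ≤ barrierRadius lam ρ m := le_csInf h fun _ hR => hR.1.le
    exact div_le_one_of_le₀ this (barrierRadius_nonneg hρ)

theorem barrier_eq_zero (hρ : 0 < ρ) (hm : 0 < m) {x : Plane}
    (hx : barrierRadius lam ρ m ≤ ‖x - p‖) : barrier lam p ρ m x = 0 := by
  refine max_eq_right (mul_nonpos_of_nonpos_of_nonneg (barrier_coeff_nonpos hρ hm) ?_)
  rcases (barrierRadius_nonneg (lam := lam) (m := m) hρ).eq_or_lt with h | h
  · simp [← h]
  · exact Real.log_nonneg ((one_le_div h).2 hx)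

theorem barrier_eq_log (hρ : 0 < ρ) (hm : 0 < m) {x : Plane}
    (hx : ‖x - p‖ ≤ barrierRadius lam ρ m) :
    barrier lam p ρ m x = m / Real.log (ρ / barrierRadius lam ρ m) *
      Real.log (‖x - p‖ / barrierRadius lam ρ m) :=
  max_eq_left (mul_nonneg_of_nonpos_of_nonpos (barrier_coeff_nonpos hρ hm)
    (Real.log_nonpos (div_nonneg (norm_nonneg _) (barrierRadius_nonneg hρ))
      (div_le_one_of_le₀ hx (barrierRadius_nonneg hρ))))

theorem barrier_le_of_le_norm (hρ : 0 < ρ) (hm : 0 < m) {d : ℝ} (hd : 0 < d) {x : Plane}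
    (hx : d ≤ ‖x - p‖) :
    barrier lam p ρ m x ≤ max (m / Real.log (ρ / barrierRadius lam ρ m) *
      Real.log (d / barrierRadius lam ρ m)) 0 := by
  refine max_le_max (mul_le_mul_of_nonpos_left ?_ (barrier_coeff_nonpos hρ hm)) le_rfl
  rcases (barrierRadius_nonneg (lam := lam) (m := m) hρ).eq_or_lt with h | h
  · simp [← h]
  · exact Real.log_le_log (by positivity) (by gcongr)

theorem harmonicAt_mul_log_div {x : Plane} (hx : x ≠ p) {R : ℝ} (hR : 0 < R) (k : ℝ) :
    HarmonicAt (fun z : Plane => k * Real.log (‖z - p‖ / R)) x := by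
  have h1 : HarmonicAt (fun z : Plane => k * Real.log ‖z - p‖ + -(k * Real.log R)) x :=
    HarmonicAt.add (harmonicAt_const_mul_log hx k) (harmonicAt_const _)
  refine (harmonicAt_congr_nhds ?_).1 h1
  filter_upwards [isOpen_ne.mem_nhds hx] with z hz
  rw [Real.log_div (norm_ne_zero_iff.2 (sub_ne_zero.2 hz)) hR.ne']
  ring

end Barrier

/-! ### The competitor and the conclusion -/

/-- A subsolution below the barrier that is small at scale `r` about `x₀` but does not vanish near
`x₀` can be replaced by one that is positive near `x₀`. -/
theorem IsSubsolution.exists_pos_near {D : Set Plane} {f g v : Plane → ℝ}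
    (hv : IsSubsolution D f g v) (hDo : IsOpen D) {lam : ℝ} (hlam : 0 < lam)
    (hf : ∀ x, lam < f x) {p : Plane} {ρ m : ℝ} (hp : p ∈ D) (hρ : 0 < ρ) (hm : 0 < m)
    (hbar : ∀ x ∉ D, v x ≤ barrier lam p ρ m x) {x₀ z : Plane} {r : ℝ}
    (hD : Disjoint (ball x₀ r) D)
    (hle : ∀ x ∈ ball x₀ r, v x ≤ √lam * Real.log 2 / 12800 * r)
    (hz : z ∈ ball x₀ (r / 16)) (hvz : 0 < v z) :
    ∃ w : Plane → ℝ, IsSubsolution D f g w ∧ (∀ x ∉ D, w x ≤ barrier lam p ρ m x) ∧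
      ∀ x ∈ ball x₀ (r / 8), 0 < w x := by
  have hr : 0 < r := by linarith [pos_of_mem_ball hz]
  have hlog2 : 0 < Real.log 2 := Real.log_pos one_lt_two
  have hzr : z ∈ ball x₀ r := ball_subset_ball (by linarith) hz
  have hfat : ∀ y ∈ closedBall x₀ (r / 2), ¬ Disjoint (ball y (r / 16)) (posSet D v) := by
    intro y hy hdis
    have hsub : ∀ y ∈ closedBall x₀ (r / 2), closedBall y (2 * (r / 16)) ⊆ ball x₀ r :=
      fun y hy => closedBall_subset_ball' (by rw [mem_closedBall] at hy; linarith)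
    have := hv.disjoint_ball_of_convex hlam hf (convex_closedBall x₀ (r / 2)) (by positivity)
      (fun y hy => hD.mono_left (hsub y hy))
      (fun y hy x hx => (hle x (hsub y hy hx)).trans (by
        have : 0 < √lam * Real.log 2 * r := by positivity
        linarith)) hy (mem_closedBall_self (by positivity)) hdis
    exact this.notMem_of_mem_left hz ⟨hD.notMem_of_mem_left hzr, hvz⟩
  set R₀ := barrierRadius lam ρ m with hR₀
  -- The circle must stay where `h` is harmonic. From a point `q` beyond `R₀`, a step of `r / 16`
  -- away from `p` gives the center of a ball of radius `r / 16` on which `h`, hence `v`, vanishes,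
  -- against `hfat`.
  have hin : ∀ q ∈ ball x₀ r, dist q x₀ ≤ r / 4 → ‖q - p‖ < R₀ := by
    intro q hqr hq
    by_contra! hqR
    have hqp : q ≠ p := fun h => hD.notMem_of_mem_left hqr (h ▸ hp)
    have hn : 0 < ‖q - p‖ := norm_pos_iff.2 (sub_ne_zero.2 hqp)
    set e : Plane := (r / 16 / ‖q - p‖) • (q - p) with he
    have hen : ‖e‖ = r / 16 := by
      rw [he, norm_smul, Real.norm_of_nonneg (by positivity), div_mul_cancel₀ _ hn.ne']
    have hcen : ‖q + e - p‖ = ‖q - p‖ + r / 16 := by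
      have : q + e - p = (1 + r / 16 / ‖q - p‖) • (q - p) := by
        rw [he, add_smul, one_smul]; abel
      rw [this, norm_smul, Real.norm_of_nonneg (by positivity)]
      field_simp
    refine hfat (q + e) ?_ ?_
    · rw [mem_closedBall]
      have : dist (q + e) q = r / 16 := by rw [dist_eq_norm]; simpa using hen
      linarith [dist_triangle (q + e) q x₀]
    · rw [Set.disjoint_left]
      intro x hx hxΩ
      rw [mem_ball, dist_comm, dist_eq_norm] at hx
      have h1 : R₀ ≤ ‖x - p‖ := by
        have : ‖q + e - p‖ ≤ ‖q + e - x‖ + ‖x - p‖ := by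
          simpa using norm_add_le (q + e - x) (x - p)
        linarith
      have h2 := hbar x hxΩ.1
      rw [barrier_eq_zero hρ hm h1] at h2
      exact h2.not_gt hxΩ.2
  obtain ⟨t, ht, hsph⟩ := hv.exists_sphere_subset_closure hlam hf hr hD hle hfat
  have htr : closedBall x₀ t ⊆ ball x₀ r := closedBall_subset_ball (by linarith [ht.2])
  have hin' : ∀ q ∈ closedBall x₀ t, ‖q - p‖ < R₀ := fun q hq =>
    hin q (htr hq) ((mem_closedBall.1 hq).trans ht.2)
  have hR₀pos : 0 < R₀ :=
    (norm_nonneg _).trans_lt (hin' x₀ (mem_closedBall_self (by linarith [ht.1])))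
  have hnp : ∀ q ∈ closedBall x₀ t, q ≠ p := fun q hq h =>
    hD.notMem_of_mem_left (htr hq) (h ▸ hp)
  obtain ⟨w, hw, hwout, hwpos, hwle⟩ := hv.exists_harmonic_replacement hDo (hD.mono_left htr) hsph
    (ball_subset_ball (by linarith [ht.1]) hz) hvz
  refine ⟨w, hw, fun x hx => ?_, fun x hx => hwpos x (ball_subset_ball ht.1 hx)⟩
  by_cases hxt : x ∈ ball x₀ t
  · have hxt' := ball_subset_closedBall hxt
    rw [barrier_eq_log hρ hm (hin' x hxt').le]
    have hharm : HarmonicOnNhd (fun z : Plane => m / Real.log (ρ / R₀) * Real.log (‖z - p‖ / R₀))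
        (closedBall x₀ t) := fun q hq => harmonicAt_mul_log_div (hnp q hq) hR₀pos _
    refine hwle _ hharm.continuousOn (hharm.mono ball_subset_closedBall) (fun q hq => ?_) x hxt'
    have hq' := sphere_subset_closedBall hq
    have := hbar q (hD.notMem_of_mem_left (htr hq'))
    rwa [barrier_eq_log hρ hm (hin' q hq').le] at this
  · rw [hwout x hxt]
    exact hbar x hx

end OnePhaseFBP

end

theorem theorem3p5 (lam Lam : ℝ) (hlam : 0 < lam) (hLam : 0 < Lam) :
    ∃ κ : ℝ, 0 < κ ∧
      ∀ (D : Set OnePhaseFBP.Plane) (f g : OnePhaseFBP.Plane → ℝ)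
        (p : OnePhaseFBP.Plane) (ρ m : ℝ),
        IsOpen D → Bornology.IsBounded D →
        Continuous f → (∀ x, lam < f x ∧ f x < Lam) →
        ContinuousOn g (frontier D) → (∀ x ∈ frontier D, 0 < g x) →
        p ∈ D → D ⊆ Metric.ball p ρ → 0 < m →
        ∀ u : OnePhaseFBP.Plane → ℝ,
          u = OnePhaseFBP.largestSubsolution D f g (OnePhaseFBP.barrier lam p ρ m) →
          ∀ x₀ ∈ frontier (OnePhaseFBP.posSet D u), ∀ r : ℝ, 0 < r →
            Disjoint (Metric.ball x₀ r) D →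
            κ * r ≤ sSup (u '' Metric.ball x₀ r) := by
  have hlog2 : 0 < Real.log 2 := Real.log_pos one_lt_two
  refine ⟨√lam * Real.log 2 / 12800, by positivity, ?_⟩
  intro D f g p ρ m hDo _ _ hf _ _ hp hDρ hm u hu x₀ hx₀ r hr hD
  have hρ : 0 < ρ := Metric.pos_of_mem_ball (hDρ hp)
  set h := OnePhaseFBP.barrier lam p ρ m with hh
  have hh0 : ∀ x, 0 ≤ h x := fun x => le_max_right _ _
  have hvu : ∀ v, OnePhaseFBP.IsSubsolution D f g v → (∀ z ∉ D, v z ≤ h z) →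
      ∀ x ∉ D, v x ≤ u x := by
    intro v hv hvh x hx
    rw [hu]
    refine le_csSup ⟨h x, ?_⟩ ⟨v, hv, hvh, rfl⟩
    rintro _ ⟨v', -, hv', rfl⟩
    exact hv' x hx
  have huh : ∀ x ∉ D, u x ≤ h x := by
    intro x hx
    rw [hu]
    refine Real.sSup_le ?_ (hh0 x)
    rintro _ ⟨v', -, hv', rfl⟩
    exact hv' x hx
  -- Needed because `sSup` of an unbounded set is `0`. The logarithm is bounded since the ball keeps
  -- a positive distance from `p`, an interior point of `D`.
  have hbdd : BddAbove (u '' Metric.ball x₀ r) := by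
    obtain ⟨d, hd, hdD⟩ := Metric.isOpen_iff.1 hDo p hp
    refine ⟨max (m / Real.log (ρ / OnePhaseFBP.barrierRadius lam ρ m) *
      Real.log (d / OnePhaseFBP.barrierRadius lam ρ m)) 0, ?_⟩
    rintro _ ⟨x, hx, rfl⟩
    have hxD := hD.notMem_of_mem_left hx
    refine (huh x hxD).trans (OnePhaseFBP.barrier_le_of_le_norm hρ hm hd ?_)
    by_contra! hlt
    exact hxD (hdD (by rwa [Metric.mem_ball, dist_eq_norm]))
  by_contra! hlt
  have hule : ∀ x ∈ Metric.ball x₀ r, u x ≤ √lam * Real.log 2 / 12800 * r := fun x hx =>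
    (le_csSup hbdd ⟨x, hx, rfl⟩).trans hlt.le
  obtain ⟨z, hz, hzΩ⟩ := mem_closure_iff.1 hx₀.1 (Metric.ball x₀ (r / 16)) Metric.isOpen_ball
    (Metric.mem_ball_self (by positivity))
  obtain ⟨v, hv, hvh, hvz⟩ : ∃ v, OnePhaseFBP.IsSubsolution D f g v ∧ (∀ z ∉ D, v z ≤ h z) ∧
      0 < v z := by
    have hpos := hzΩ.2
    rw [hu, OnePhaseFBP.largestSubsolution] at hpos
    by_contra! hno
    refine hpos.not_ge (Real.sSup_le ?_ le_rfl)
    rintro _ ⟨v, hv, hvh, rfl⟩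
    exact hno v hv hvh
  obtain ⟨w, hw, hwh, hwpos⟩ := hv.exists_pos_near hDo hlam (fun x => (hf x).1) hp hρ hm hvh hD
    (fun x hx => (hvu v hv hvh x (hD.notMem_of_mem_left hx)).trans (hule x hx)) hz hvz
  -- Positivity of `w ≤ u` near `x₀` contradicts that `x₀` is a boundary point.
  refine hx₀.2 (mem_interior.2 ⟨Metric.ball x₀ (r / 8), fun x hx => ?_, Metric.isOpen_ball,
    Metric.mem_ball_self (by positivity)⟩)
  have hxD := hD.notMem_of_mem_left (Metric.ball_subset_ball (by linarith) hx)
  exact ⟨hxD, (hwpos x hx).trans_le (hvu w hw hwh x hxD)⟩
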